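/- Let $0<l<\infty$ and $\theta\in\mathbb{C}$ with $|\theta|=1$. Let $\zeta_1=1$, $\zeta_2=\frac12(-1+i\sqrt3)$, $\zeta_3=\frac12(-1-i\sqrt3)$ and $$s_p(z)=\frac13\sum_{k=1}^3\frac1{\zeta_k^p}e^{z\zeta_k}\qquad(p=0,1,2).$$ Let $L_0(\theta)$ be the operator $L_0(\theta)y=iy'''$ in $L^2(0,l)$ with domain $$\{y\in W_2^3(0,l):\ y(0)=0,\ y'(l)=\theta y'(0),\ y(l)=0\},$$ and let $\Delta_\theta(0,\lambda)$ be the entire function $$\Delta_\theta(0,\lambda)=-\frac{1}{(i\lambda)^2}\left[\theta s_2(i\lambda l)+s_2(-i\lambda l)\right],\qquad \Delta_\theta(0,0)=-\frac{l^2}{2}(\theta+1).$$ Then the real zeros of $\Delta_\theta(0,\cdot)$ form a strictly increasing two-sided sequence $\{\lambda_n(0,\theta)\}_{n\in\mathbb{Z}}$, and the spectrum of $L_0(\theta)$ is $$\sigma(L_0(\theta))=\{\lambda_n^3(0,\theta):n\in\mathbb{Z}\}.$$ The spectrum is simple: every point of it is an eigenvalue with a one-dimensional eigenspace. For $\lambda=\lambda_n(0,\theta)$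 the eigenspace for $\lambda^3$ is spanned by the function $$\psi_n(0,\lambda,x)=\frac1{a_n(\lambda)}\left\{\frac{s_2(i\lambda x)}{(i\lambda)^2}\cdot\frac{s_1(i\lambda l)}{i\lambda}-\frac{s_1(i\lambda x)}{i\lambda}\cdot\frac{s_2(i\lambda l)}{(i\lambda)^2}\right\},$$ where the number $a_n(\lambda)>0$ is determined by $\|\psi_n(0,\lambda,\cdot)\|_{L^2(0,l)}=1$; for $\lambda=0$ (which is a zero of $\Delta_\theta(0,\cdot)$ only if $\theta=-1$) the quotients $s_1(i\lambda x)/(i\lambda)$ and $s_2(i\lambda x)/(i\lambda)^2$ are replaced by their limits $x$ and $x^2/2$, so that $\psi$ is a multiple of $x^2-lx$. Moreover $\psi_n(0,\lambda\zeta_2,x)=\psi_n(0,\lambda,x)$, where for complex $\lambda$ the function $\psi_n(0,\lambda,\cdot)$ is defined by the same formula, with $a_n(\lambda)\ge 0$ the $L^2(0,l)$-norm of the expression in braces (and $\psi_n(0,\lambda,\cdot)=0$ if that expression vanishes identically). -/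

import Mathlib

open MeasureTheory Set

noncomputable section

/-- The cube roots of unity `1`, `(-1 + i√3)/2`, `(-1 - i√3)/2`. -/
def zeta : Fin 3 → ℂ :=
  ![1, (-1 + Complex.I * (Real.sqrt 3 : ℝ)) / 2, (-1 - Complex.I * (Real.sqrt 3 : ℝ)) / 2]

/-- The generalized trigonometric functions `s_p(z) = (1/3) ∑ₖ ζₖ^(-p) exp(z ζₖ)`. -/
def trigS (p : ℕ) (z : ℂ) : ℂ :=
  (1 / 3) * ∑ k : Fin 3, (1 / zeta k ^ p) * Complex.exp (z * zeta k)

/-- The function `s₁(iλx) / (iλ)`, entire in `λ`; its value at `λ = 0` is `x`. -/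
def solOne (lam : ℂ) (x : ℝ) : ℂ :=
  if lam = 0 then (x : ℂ) else trigS 1 (Complex.I * lam * x) / (Complex.I * lam)

/-- The function `s₂(iλx) / (iλ)²`, entire in `λ`; its value at `λ = 0` is `x²/2`. -/
def solTwo (lam : ℂ) (x : ℝ) : ℂ :=
  if lam = 0 then (x : ℂ) ^ 2 / 2 else trigS 2 (Complex.I * lam * x) / (Complex.I * lam) ^ 2

/-- The characteristic function `Δ_θ(0, λ) = -(θ s₂(iλl) + s₂(-iλl)) / (iλ)²`, an entire function
of `λ`; its value at the removable singularity `λ = 0` is `-(l²/2)(θ + 1)`. -/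
def charFn (l : ℝ) (θ lam : ℂ) : ℂ :=
  if lam = 0 then -((l : ℂ) ^ 2 / 2) * (θ + 1)
  else -(1 / (Complex.I * lam) ^ 2) *
    (θ * trigS 2 (Complex.I * lam * l) + trigS 2 (-(Complex.I * lam * l)))

/-- `s₂(iλx)/(iλ)² · s₁(iλl)/(iλ) - s₁(iλx)/(iλ) · s₂(iλl)/(iλ)²`. -/
def eigenFnRaw (l : ℝ) (lam : ℂ) (x : ℝ) : ℂ :=
  solTwo lam x * solOne lam l - solOne lam x * solTwo lam l

/-- The normalizing number `a(λ)`: the `L²(0,l)` norm of the unnormalized function. -/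
def normConst (l : ℝ) (lam : ℂ) : ℝ :=
  Real.sqrt (∫ x in (0 : ℝ)..l, ‖eigenFnRaw l lam x‖ ^ 2)

/-- The normalized function `ψ(0, λ, x)`. -/
def eigenFn (l : ℝ) (lam : ℂ) (x : ℝ) : ℂ :=
  (1 / (normConst l lam : ℂ)) * eigenFnRaw l lam x

/-- The Hilbert space `L²(0, l)` of complex functions. -/
abbrev L2Interval (l : ℝ) : Type := Lp ℂ 2 (volume.restrict (Ioo (0 : ℝ) l))

/-- `y` belongs to the Sobolev space `W₂³(0, l)` (more precisely it is the `C²` representative on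
`[0, l]`), with derivatives `y' = y₁`, `y'' = y₂` on `[0, l]`, where `y₂` is absolutely continuous
with almost everywhere derivative `y''' = y₃ ∈ L²(0, l)`. -/
structure IsSobolevThree (l : ℝ) (y y₁ y₂ y₃ : ℝ → ℂ) : Prop where
  hasDeriv_zero : ∀ x ∈ Icc 0 l, HasDerivWithinAt y (y₁ x) (Icc 0 l) x
  hasDeriv_one : ∀ x ∈ Icc 0 l, HasDerivWithinAt y₁ (y₂ x) (Icc 0 l) x
  absCont : AbsolutelyContinuousOnInterval y₂ 0 l
  ae_hasDeriv : ∀ᵐ x ∂volume.restrict (Ioo (0 : ℝ) l), HasDerivAt y₂ (y₃ x) x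
  memLp : MemLp y₃ 2 (volume.restrict (Ioo (0 : ℝ) l))

/-- The graph of `L₀(θ)`: pairs `(y, i y''')` with `y ∈ W₂³(0, l)`, `y(0) = 0`,
`y'(l) = θ y'(0)`, `y(l) = 0`. -/
def opGraph (l : ℝ) (θ : ℂ) : Submodule ℂ (L2Interval l × L2Interval l) where
  carrier := {p | ∃ y y₁ y₂ y₃ : ℝ → ℂ, IsSobolevThree l y y₁ y₂ y₃ ∧
    y 0 = 0 ∧ y₁ l = θ * y₁ 0 ∧ y l = 0 ∧
    (p.1 : ℝ → ℂ) =ᵐ[volume.restrict (Ioo (0 : ℝ) l)] y ∧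
    (p.2 : ℝ → ℂ) =ᵐ[volume.restrict (Ioo (0 : ℝ) l)] fun x => Complex.I * y₃ x}
  zero_mem' := by
    refine ⟨0, 0, 0, 0, ⟨?_, ?_, ?_, ?_, ?_⟩, by simp, by simp, by simp, ?_, ?_⟩
    · intro x _; exact hasDerivWithinAt_const x _ (0 : ℂ)
    · intro x _; exact hasDerivWithinAt_const x _ (0 : ℂ)
    · simp [absolutelyContinuousOnInterval_iff]
      intro ε hε; exact ⟨1, one_pos, fun _ _ _ _ => hε⟩
    · exact Filter.Eventually.of_forall fun x => hasDerivAt_const x (0 : ℂ)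
    · exact MemLp.zero
    · exact Lp.coeFn_zero _ _ _
    · filter_upwards [Lp.coeFn_zero ℂ 2 (volume.restrict (Ioo (0 : ℝ) l))] with x hx
      simpa using hx
  add_mem' := by
    rintro ⟨p, p'⟩ ⟨q, q'⟩ ⟨y, y₁, y₂, y₃, hy, a, b, c, d, e⟩ ⟨z, z₁, z₂, z₃, hz, a', b', c', d', e'⟩
    refine ⟨y + z, y₁ + z₁, y₂ + z₂, y₃ + z₃, ⟨?_, ?_, ?_, ?_, ?_⟩, ?_, ?_, ?_, ?_, ?_⟩
    · intro x hx; exact (hy.hasDeriv_zero x hx).add (hz.hasDeriv_zero x hx)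
    · intro x hx; exact (hy.hasDeriv_one x hx).add (hz.hasDeriv_one x hx)
    · exact hy.absCont.add hz.absCont
    · filter_upwards [hy.ae_hasDeriv, hz.ae_hasDeriv] with x h h'
      exact h.add h'
    · exact hy.memLp.add hz.memLp
    · simp [a, a']
    · simp [b, b', mul_add]
    · simp [c, c']
    · filter_upwards [Lp.coeFn_add p q, d, d'] with x h h1 h2
      simp_all
    · filter_upwards [Lp.coeFn_add p' q', e, e'] with x h h1 h2
      simp_all [mul_add]
  smul_mem' := by
    rintro r ⟨p, p'⟩ ⟨y, y₁, y₂, y₃, hy, a, b, c, d, e⟩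
    refine ⟨r • y, r • y₁, r • y₂, r • y₃, ⟨?_, ?_, ?_, ?_, ?_⟩, ?_, ?_, ?_, ?_, ?_⟩
    · intro x hx; exact (hy.hasDeriv_zero x hx).const_smul r
    · intro x hx; exact (hy.hasDeriv_one x hx).const_smul r
    · exact hy.absCont.const_smul r
    · filter_upwards [hy.ae_hasDeriv] with x h
      exact h.const_smul r
    · exact hy.memLp.const_smul r
    · simp [a]
    · simp [b]; ring
    · simp [c]
    · filter_upwards [Lp.coeFn_smul r p, d] with x h h1
      simp_all
    · filter_upwards [Lp.coeFn_smul r p', e] with x h h1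
      simp_all
      ring

/-- The third derivative is determined by the class of `y`, so that `opGraph` is a graph. -/
theorem opGraph_functional {l : ℝ} (hl : 0 < l) (θ : ℂ)
    (p : L2Interval l × L2Interval l) (hp : p ∈ opGraph l θ) (h0 : p.1 = 0) : p.2 = 0 := by
  obtain ⟨y, y₁, y₂, y₃, hy, -, -, -, d, e⟩ := hp
  have hU : UniqueDiffOn ℝ (Icc 0 l) := uniqueDiffOn_Icc hl
  have hc : ContinuousOn y (Icc 0 l) := fun x hx => (hy.hasDeriv_zero x hx).continuousWithinAt
  have hy0 : ∀ x ∈ Icc 0 l, y x = 0 := by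
    have hae : y =ᵐ[volume.restrict (Ioo (0 : ℝ) l)] fun _ => (0 : ℂ) := by
      rw [h0] at d
      filter_upwards [d, Lp.coeFn_zero ℂ 2 (volume.restrict (Ioo (0 : ℝ) l))] with x h1 h2
      rw [← h1, h2]; rfl
    have hopen : EqOn y (fun _ => (0 : ℂ)) (Ioo 0 l) :=
      Measure.eqOn_open_of_ae_eq hae isOpen_Ioo (hc.mono Ioo_subset_Icc_self) continuousOn_const
    have := hopen.of_subset_closure hc continuousOn_const Ioo_subset_Icc_self
      (by rw [closure_Ioo hl.ne])
    exact fun x hx => this hx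
  have step : ∀ f g : ℝ → ℂ, (∀ x ∈ Icc 0 l, f x = 0) →
      (∀ x ∈ Icc 0 l, HasDerivWithinAt f (g x) (Icc 0 l) x) → ∀ x ∈ Icc 0 l, g x = 0 := by
    intro f g hf hg x hx
    have h1 : HasDerivWithinAt f 0 (Icc 0 l) x :=
      (hasDerivWithinAt_const x (Icc 0 l) (0 : ℂ)).congr hf (hf x hx)
    exact (hU x hx).eq_deriv _ (hg x hx) h1
  have hy2 := step _ _ (step _ _ hy0 hy.hasDeriv_zero) hy.hasDeriv_one
  have hy3 : ∀ᵐ x ∂volume.restrict (Ioo (0 : ℝ) l), y₃ x = 0 := by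
    filter_upwards [hy.ae_hasDeriv, ae_restrict_mem measurableSet_Ioo] with x h hx
    have h1 : HasDerivAt y₂ 0 x := (hasDerivAt_const x (0 : ℂ)).congr_of_eventuallyEq
      (by filter_upwards [Icc_mem_nhds hx.1 hx.2] with t ht using hy2 t ht)
    exact h.unique h1
  refine Lp.ext ?_
  filter_upwards [e, hy3, Lp.coeFn_zero ℂ 2 (volume.restrict (Ioo (0 : ℝ) l))] with x h1 h2 h3
  rw [h1, h2, h3]; simp

/-- The operator `L₀(θ) y = i y'''` in `L²(0, l)` with domain
`{y ∈ W₂³(0, l) : y(0) = 0, y'(l) = θ y'(0), y(l) = 0}`. -/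
def opL (l : ℝ) (θ : ℂ) : L2Interval l →ₗ.[ℂ] L2Interval l := (opGraph l θ).toLinearPMap

theorem opL_graph {l : ℝ} (hl : 0 < l) (θ : ℂ) : (opL l θ).graph = opGraph l θ :=
  Submodule.toLinearPMap_graph_eq _ (opGraph_functional hl θ)

/-- The spectrum of an unbounded operator `A`: the complement of the set of those `z` for which
`A - z` maps the domain bijectively onto the space with a bounded inverse `R`. -/
def unboundedSpectrum {H : Type*} [NormedAddCommGroup H] [NormedSpace ℂ H]
    (A : H →ₗ.[ℂ] H) : Set ℂ :=
  {z | ¬ ∃ R : H →L[ℂ] H,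
    (∀ f : H, ∃ h : R f ∈ A.domain, A ⟨R f, h⟩ - z • R f = f) ∧
    (∀ y : A.domain, R (A y - z • (y : H)) = y)}

/-- The eigenspace `{y ∈ D(A) : A y = μ y}` of an unbounded operator. -/
def unboundedEigenspace {H : Type*} [NormedAddCommGroup H] [NormedSpace ℂ H]
    (A : H →ₗ.[ℂ] H) (μ : ℂ) : Submodule ℂ H :=
  (LinearMap.ker (A.toFun - μ • A.domain.subtype)).map A.domain.subtype

end

/-! ### Algebra of the generalized trigonometric functions -/

/-! Every complex number is a cube `λ³`, and `i y''' = λ³ y` means `y''' = (iλ)³ y`. Its solutions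
are spanned by `solZero`, `solOne`, `solTwo` (`IsSobolevThree.eq_sol`). The condition `y(0) = 0`
leaves two coefficients, and the determinant of the other two conditions is `-charFn`
(`charFn_eq_det`, resting on `trigS_sq_sub`). If it vanishes, there is an eigenvector. If not, the
kernel is trivial, and variation of constants with a boundary correction gives surjectivity
(`exists_mem_opGraph`).

Since `|θ| = 1`, Lagrange's identity makes the operator symmetric (`inner_opGraph`). Hence
eigenvalues are real, and surjectivity at `z` and its conjugate makes the inverse bounded
(`notMem_unboundedSpectrum_of_symmetric`). As `charFn` depends only on `λ³`, each spectral point is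
the cube of a real zero.

With `θ = c²`, the restriction to the real axis is a nonvanishing factor times the real function
`realChar`, off `λ = 0`. This function oscillates with amplitude `exp(√3|t|/2)`, so its zeros are
unbounded in both directions; the identity theorem makes them locally finite, so they can be indexed
by `ℤ`.

For real `λ` the values of `solOne` and `solTwo` at `l` are not both zero (`solOne_solTwo_ne_zero`).
Then `y(l) = 0` alone fixes the solution up to a scalar, which gives simplicity and the formula for
the eigenfunction. -/

lemma zeta_zero : zeta 0 = 1 := rfl

lemma zeta_one_quadratic : zeta 1 ^ 2 + zeta 1 + 1 = 0 := by
  have h3 : ((Real.sqrt 3 : ℝ) : ℂ) ^ 2 = 3 := by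
    rw [← Complex.ofReal_pow, Real.sq_sqrt (by norm_num)]; norm_num
  simp only [zeta, Matrix.cons_val_one, Matrix.cons_val_zero]
  linear_combination (1 / 4 : ℂ) * Complex.I ^ 2 * h3 + (3 / 4 : ℂ) * Complex.I_sq

lemma zeta_two : zeta 2 = zeta 1 ^ 2 := by
  have h : zeta 2 = -1 - zeta 1 := by
    simp only [zeta, Matrix.cons_val_one, Matrix.cons_val_zero, Matrix.cons_val]
    ring
  linear_combination h - zeta_one_quadratic

lemma zeta_one_cube : zeta 1 ^ 3 = 1 := by
  linear_combination (zeta 1 - 1) * zeta_one_quadratic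

lemma zeta_one_ne_zero : zeta 1 ≠ 0 := by
  intro h
  have := zeta_one_cube
  simp [h] at this

lemma inv_zeta_one : (zeta 1)⁻¹ = zeta 1 ^ 2 :=
  inv_eq_of_mul_eq_one_right (by linear_combination zeta_one_cube)

lemma trigS_zero_eq (z : ℂ) : trigS 0 z =
    (Complex.exp z + Complex.exp (z * zeta 1) + Complex.exp (z * zeta 1 ^ 2)) / 3 := by
  simp [trigS, Fin.sum_univ_three, zeta_zero, zeta_two]
  ring

lemma trigS_one_eq (z : ℂ) : trigS 1 z =
    (Complex.exp z + zeta 1 ^ 2 * Complex.exp (z * zeta 1)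
      + zeta 1 * Complex.exp (z * zeta 1 ^ 2)) / 3 := by
  simp only [trigS, Fin.sum_univ_three, zeta_zero, zeta_two, one_div, pow_one, inv_zeta_one,
    ← inv_pow, mul_one, inv_one, one_mul]
  linear_combination (1 / 3 : ℂ) * zeta 1 * Complex.exp (z * zeta 1 ^ 2) * zeta_one_cube

lemma trigS_two_eq (z : ℂ) : trigS 2 z =
    (Complex.exp z + zeta 1 * Complex.exp (z * zeta 1)
      + zeta 1 ^ 2 * Complex.exp (z * zeta 1 ^ 2)) / 3 := by
  simp only [trigS, Fin.sum_univ_three, zeta_zero, zeta_two, one_div, inv_zeta_one,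
    ← inv_pow, mul_one, inv_one, one_mul, one_pow]
  linear_combination (1 / 3 : ℂ) * (zeta 1 * Complex.exp (z * zeta 1)
    + (zeta 1 ^ 5 + zeta 1 ^ 2) * Complex.exp (z * zeta 1 ^ 2)) * zeta_one_cube

lemma exp_mul_exp_mul_exp_zeta (z : ℂ) :
    Complex.exp z * Complex.exp (z * zeta 1) * Complex.exp (z * zeta 1 ^ 2) = 1 := by
  rw [← Complex.exp_add, ← Complex.exp_add, ← Complex.exp_zero]
  congr 1
  linear_combination z * zeta_one_quadratic

/-- The three exponentials have product one, so each inverse is the product of the other two and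
`s₂(-z)` is quadratic in them. This identity turns the boundary determinant into the closed form of
`charFn`. -/
lemma trigS_sq_sub (z : ℂ) : trigS 1 z ^ 2 - trigS 0 z * trigS 2 z = trigS 2 (-z) := by
  have h := exp_mul_exp_mul_exp_zeta z
  rw [trigS_zero_eq, trigS_one_eq, trigS_two_eq, trigS_two_eq]
  simp only [neg_mul, Complex.exp_neg]
  have ha : (Complex.exp z)⁻¹ = Complex.exp (z * zeta 1) * Complex.exp (z * zeta 1 ^ 2) :=
    inv_eq_of_mul_eq_one_right (by linear_combination h)
  have hb : (Complex.exp (z * zeta 1))⁻¹ = Complex.exp z * Complex.exp (z * zeta 1 ^ 2) :=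
    inv_eq_of_mul_eq_one_right (by linear_combination h)
  have hc : (Complex.exp (z * zeta 1 ^ 2))⁻¹ = Complex.exp z * Complex.exp (z * zeta 1) :=
    inv_eq_of_mul_eq_one_right (by linear_combination h)
  rw [ha, hb, hc]
  generalize Complex.exp (z * zeta 1 ^ 2) = C
  generalize Complex.exp (z * zeta 1) = B
  generalize Complex.exp z = A
  have hq := zeta_one_quadratic
  have h2 : zeta 1 ^ 2 = -1 - zeta 1 := by linear_combination hq
  have h3 := zeta_one_cube
  generalize zeta 1 = w at *
  have h4 : w ^ 4 = w := by linear_combination w * h3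
  ring_nf
  simp only [h4, h3, h2]
  ring

/-- The `s_p` are the components of the exponential under the characters of `ℤ/3`. In each of the
three addition formulas the indices of a product add up to `p` modulo 3. -/
lemma trigS_add_two (u v : ℂ) : trigS 2 (u + v) =
    trigS 2 u * trigS 0 v + trigS 1 u * trigS 1 v + trigS 0 u * trigS 2 v := by
  simp only [trigS_zero_eq, trigS_one_eq, trigS_two_eq, add_mul, Complex.exp_add]
  have h3 := zeta_one_cube
  have h2 : zeta 1 ^ 2 = -1 - zeta 1 := by linear_combination zeta_one_quadratic
  have h4 : zeta 1 ^ 4 = zeta 1 := by linear_combination zeta 1 * h3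
  generalize Complex.exp (u * zeta 1 ^ 2) = C
  generalize Complex.exp (u * zeta 1) = B
  generalize Complex.exp u = A
  generalize Complex.exp (v * zeta 1 ^ 2) = C'
  generalize Complex.exp (v * zeta 1) = B'
  generalize Complex.exp v = A'
  generalize zeta 1 = w at *
  ring_nf
  simp only [h4, h3, h2]
  ring

lemma trigS_add_one (u v : ℂ) : trigS 1 (u + v) =
    trigS 1 u * trigS 0 v + trigS 0 u * trigS 1 v + trigS 2 u * trigS 2 v := by
  simp only [trigS_zero_eq, trigS_one_eq, trigS_two_eq, add_mul, Complex.exp_add]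
  have h3 := zeta_one_cube
  have h2 : zeta 1 ^ 2 = -1 - zeta 1 := by linear_combination zeta_one_quadratic
  have h4 : zeta 1 ^ 4 = zeta 1 := by linear_combination zeta 1 * h3
  generalize Complex.exp (u * zeta 1 ^ 2) = C
  generalize Complex.exp (u * zeta 1) = B
  generalize Complex.exp u = A
  generalize Complex.exp (v * zeta 1 ^ 2) = C'
  generalize Complex.exp (v * zeta 1) = B'
  generalize Complex.exp v = A'
  generalize zeta 1 = w at *
  ring_nf
  simp only [h4, h3, h2]
  ring

lemma trigS_add_zero (u v : ℂ) : trigS 0 (u + v) =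
    trigS 0 u * trigS 0 v + trigS 1 u * trigS 2 v + trigS 2 u * trigS 1 v := by
  simp only [trigS_zero_eq, trigS_one_eq, trigS_two_eq, add_mul, Complex.exp_add]
  have h3 := zeta_one_cube
  have h2 : zeta 1 ^ 2 = -1 - zeta 1 := by linear_combination zeta_one_quadratic
  have h4 : zeta 1 ^ 4 = zeta 1 := by linear_combination zeta 1 * h3
  generalize Complex.exp (u * zeta 1 ^ 2) = C
  generalize Complex.exp (u * zeta 1) = B
  generalize Complex.exp u = A
  generalize Complex.exp (v * zeta 1 ^ 2) = C'
  generalize Complex.exp (v * zeta 1) = B'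
  generalize Complex.exp v = A'
  generalize zeta 1 = w at *
  ring_nf
  simp only [h4, h3, h2]
  ring

/-- Multiplication by `ζ` permutes the three exponentials cyclically, so `s_p` acquires the factor
`ζ^p`. Division by `(iλ)^p` cancels it, whence the invariance under `λ ↦ λζ`. -/
lemma trigS_zero_mul_zeta (z : ℂ) : trigS 0 (z * zeta 1) = trigS 0 z := by
  have h : z * zeta 1 * zeta 1 ^ 2 = z := by linear_combination z * zeta_one_cube
  have h' : z * zeta 1 * zeta 1 = z * zeta 1 ^ 2 := by ring
  rw [trigS_zero_eq, trigS_zero_eq, h, h']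
  ring

lemma trigS_one_mul_zeta (z : ℂ) : trigS 1 (z * zeta 1) = zeta 1 * trigS 1 z := by
  have h : z * zeta 1 * zeta 1 ^ 2 = z := by linear_combination z * zeta_one_cube
  have h' : z * zeta 1 * zeta 1 = z * zeta 1 ^ 2 := by ring
  rw [trigS_one_eq, trigS_one_eq, h, h']
  linear_combination (-1 / 3 : ℂ) * Complex.exp (z * zeta 1) * zeta_one_cube

lemma trigS_two_mul_zeta (z : ℂ) : trigS 2 (z * zeta 1) = zeta 1 ^ 2 * trigS 2 z := by
  have h : z * zeta 1 * zeta 1 ^ 2 = z := by linear_combination z * zeta_one_cube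
  have h' : z * zeta 1 * zeta 1 = z * zeta 1 ^ 2 := by ring
  rw [trigS_two_eq, trigS_two_eq, h, h']
  linear_combination (-1 / 3 : ℂ) * (Complex.exp (z * zeta 1) +
    zeta 1 * Complex.exp (z * zeta 1 ^ 2)) * zeta_one_cube

lemma hasDerivAt_trigS_succ (p : ℕ) (z : ℂ) : HasDerivAt (trigS (p + 1)) (trigS p z) z := by
  have hne : ∀ k, zeta k ≠ 0 := by
    intro k
    fin_cases k
    · simp [zeta_zero]
    · exact zeta_one_ne_zero
    · simpa [zeta_two] using zeta_one_ne_zero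
  have h : ∀ k : Fin 3, HasDerivAt (fun z => (1 / zeta k ^ (p + 1)) * Complex.exp (z * zeta k))
      ((1 / zeta k ^ p) * Complex.exp (z * zeta k)) z := by
    intro k
    have h1 := (((hasDerivAt_id z).mul_const (zeta k)).cexp).const_mul (1 / zeta k ^ (p + 1))
    refine h1.congr_deriv ?_
    have := hne k
    simp only [id]
    field_simp
    ring
  exact (HasDerivAt.fun_sum fun k _ => h k).const_mul (1 / 3 : ℂ)

lemma trigS_add_three (p : ℕ) : trigS (p + 3) = trigS p := by
  have h : ∀ k, zeta k ^ 3 = 1 := by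
    intro k
    fin_cases k
    · simp [zeta_zero]
    · exact zeta_one_cube
    · simp only [Fin.reduceFinMk, zeta_two]
      linear_combination (zeta 1 ^ 3 + 1) * zeta_one_cube
  funext z
  simp [trigS, pow_add, h]

/-! ### The fundamental system and the characteristic determinant -/

/-- The solution `s₀(iλx)` of `i y''' = λ³ y`. -/
noncomputable def solZero (lam : ℂ) (x : ℝ) : ℂ := trigS 0 (Complex.I * lam * x)

lemma trigS_zero_zero : trigS 0 0 = 1 := by simp [trigS_zero_eq]; norm_num

lemma trigS_one_zero : trigS 1 0 = 0 := by
  simp [trigS_one_eq]; linear_combination zeta_one_quadratic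

lemma trigS_two_zero : trigS 2 0 = 0 := by
  simp [trigS_two_eq]; linear_combination zeta_one_quadratic

@[simp] lemma solZero_zero (lam : ℂ) : solZero lam 0 = 1 := by simp [solZero, trigS_zero_zero]

@[simp] lemma solOne_zero (lam : ℂ) : solOne lam 0 = 0 := by simp [solOne, trigS_one_zero]

@[simp] lemma solTwo_zero (lam : ℂ) : solTwo lam 0 = 0 := by simp [solTwo, trigS_two_zero]

lemma hasDerivAt_trigS_comp (p : ℕ) (lam : ℂ) (x : ℝ) :
    HasDerivAt (fun x : ℝ => trigS (p + 1) (Complex.I * lam * x))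
      (trigS p (Complex.I * lam * x) * (Complex.I * lam)) x := by
  have h : HasDerivAt (fun x : ℝ => Complex.I * lam * (x : ℂ)) (Complex.I * lam) x := by
    simpa using (Complex.ofRealCLM.hasDerivAt (x := x)).const_mul (Complex.I * lam)
  exact (hasDerivAt_trigS_succ p _).comp x h

lemma hasDerivAt_solTwo (lam : ℂ) (x : ℝ) : HasDerivAt (solTwo lam) (solOne lam x) x := by
  by_cases h : lam = 0
  · subst h
    have h1 := ((Complex.ofRealCLM.hasDerivAt (x := x)).pow 2).div_const 2
    unfold solTwo solOne
    simp only [if_true]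
    refine (h1.congr_deriv ?_)
    simp
  · have h1 := (hasDerivAt_trigS_comp 1 lam x).div_const ((Complex.I * lam) ^ 2)
    unfold solTwo solOne
    simp only [if_neg h]
    refine h1.congr_deriv ?_
    have := Complex.I_ne_zero
    field_simp

lemma hasDerivAt_solOne (lam : ℂ) (x : ℝ) : HasDerivAt (solOne lam) (solZero lam x) x := by
  by_cases h : lam = 0
  · subst h
    have h1 := Complex.ofRealCLM.hasDerivAt (x := x)
    unfold solOne
    simp only [if_true]
    refine (h1.congr_deriv ?_)
    simp [solZero, trigS_zero_zero]
  · have h1 := (hasDerivAt_trigS_comp 0 lam x).div_const (Complex.I * lam)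
    unfold solOne solZero
    simp only [if_neg h]
    refine h1.congr_deriv ?_
    have := Complex.I_ne_zero
    field_simp

lemma hasDerivAt_solZero (lam : ℂ) (x : ℝ) :
    HasDerivAt (solZero lam) ((Complex.I * lam) ^ 3 * solTwo lam x) x := by
  have h1 := hasDerivAt_trigS_comp 2 lam x
  -- Periodicity in `p` closes the cycle: `s₀` is `s₃`, whose derivative is `s₂`.
  simp only [Nat.reduceAdd, show trigS 3 = trigS 0 from trigS_add_three 0] at h1
  refine h1.congr_deriv ?_
  by_cases h : lam = 0
  · simp [h]
  · have := Complex.I_ne_zero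
    rw [solTwo, if_neg h]
    field_simp

lemma continuous_solZero (lam : ℂ) : Continuous (solZero lam) :=
  continuous_iff_continuousAt.2 fun x => (hasDerivAt_solZero lam x).continuousAt

lemma continuous_solOne (lam : ℂ) : Continuous (solOne lam) :=
  continuous_iff_continuousAt.2 fun x => (hasDerivAt_solOne lam x).continuousAt

lemma continuous_solTwo (lam : ℂ) : Continuous (solTwo lam) :=
  continuous_iff_continuousAt.2 fun x => (hasDerivAt_solTwo lam x).continuousAt

/-- This formula and the next two are needed on the diagonal `x = t`, where the left side is an
initial value; there they collapse the extra terms in variation of constants. -/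
lemma solTwo_sub (lam : ℂ) (x t : ℝ) : solTwo lam (x - t) =
    solTwo lam x * solZero lam (-t) + solOne lam x * solOne lam (-t)
      + solZero lam x * solTwo lam (-t) := by
  by_cases h : lam = 0
  · simp [solTwo, solOne, solZero, h, trigS_zero_zero]; ring
  · have hI := Complex.I_ne_zero
    have e : Complex.I * lam * ((x - t : ℝ) : ℂ) =
      Complex.I * lam * x + Complex.I * lam * ((-t : ℝ) : ℂ) := by push_cast; ring
    simp only [solTwo, solOne, solZero, if_neg h]
    rw [e, trigS_add_two]
    field_simp

lemma solOne_sub (lam : ℂ) (x t : ℝ) : solOne lam (x - t) =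
    solOne lam x * solZero lam (-t) + solZero lam x * solOne lam (-t)
      + (Complex.I * lam) ^ 3 * (solTwo lam x * solTwo lam (-t)) := by
  by_cases h : lam = 0
  · simp [solTwo, solOne, solZero, h, trigS_zero_zero]; ring
  · have hI := Complex.I_ne_zero
    have e : Complex.I * lam * ((x - t : ℝ) : ℂ) =
      Complex.I * lam * x + Complex.I * lam * ((-t : ℝ) : ℂ) := by push_cast; ring
    simp only [solTwo, solOne, solZero, if_neg h]
    rw [e, trigS_add_one]
    field_simp

lemma solZero_sub (lam : ℂ) (x t : ℝ) : solZero lam (x - t) =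
    solZero lam x * solZero lam (-t)
      + (Complex.I * lam) ^ 3 * (solOne lam x * solTwo lam (-t) + solTwo lam x * solOne lam (-t)) := by
  by_cases h : lam = 0
  · simp [solZero, h, trigS_zero_zero]
  · have hI := Complex.I_ne_zero
    have e : Complex.I * lam * ((x - t : ℝ) : ℂ) =
      Complex.I * lam * x + Complex.I * lam * ((-t : ℝ) : ℂ) := by push_cast; ring
    simp only [solTwo, solOne, solZero, if_neg h]
    rw [e, trigS_add_zero]
    field_simp
    ring

/-- The characteristic function is the determinant of the boundary conditions on the span of
`solOne` and `solTwo`, up to sign. -/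
lemma charFn_eq_det (l : ℝ) (θ lam : ℂ) : charFn l θ lam =
    solTwo lam l * (solZero lam l - θ) - solOne lam l ^ 2 := by
  by_cases h : lam = 0
  · simp [solTwo, solOne, solZero, h, charFn, trigS_zero_zero]; ring
  · have hI := Complex.I_ne_zero
    simp only [solTwo, solOne, solZero, charFn, if_neg h]
    rw [← trigS_sq_sub]
    field_simp
    ring

lemma solOne_mul_zeta (lam : ℂ) (x : ℝ) : solOne (lam * zeta 1) x = solOne lam x := by
  by_cases h : lam = 0
  · simp [h]
  · have hI := Complex.I_ne_zero
    have hz := zeta_one_ne_zero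
    have e : Complex.I * (lam * zeta 1) * x = Complex.I * lam * x * zeta 1 := by ring
    simp only [solOne, if_neg h, if_neg (mul_ne_zero h hz)]
    rw [e, trigS_one_mul_zeta]
    field_simp

lemma solTwo_mul_zeta (lam : ℂ) (x : ℝ) : solTwo (lam * zeta 1) x = solTwo lam x := by
  by_cases h : lam = 0
  · simp [h]
  · have hI := Complex.I_ne_zero
    have hz := zeta_one_ne_zero
    have e : Complex.I * (lam * zeta 1) * x = Complex.I * lam * x * zeta 1 := by ring
    simp only [solTwo, if_neg h, if_neg (mul_ne_zero h hz)]
    rw [e, trigS_two_mul_zeta]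
    field_simp

lemma solZero_mul_zeta (lam : ℂ) (x : ℝ) : solZero (lam * zeta 1) x = solZero lam x := by
  have e : Complex.I * (lam * zeta 1) * x = Complex.I * lam * x * zeta 1 := by ring
  simp only [solZero]
  rw [e, trigS_zero_mul_zeta]

lemma charFn_mul_zeta (l : ℝ) (θ lam : ℂ) : charFn l θ (lam * zeta 1) = charFn l θ lam := by
  simp only [charFn_eq_det, solZero_mul_zeta, solOne_mul_zeta, solTwo_mul_zeta]

lemma eigenFnRaw_mul_zeta (l : ℝ) (lam : ℂ) (x : ℝ) :
    eigenFnRaw l (lam * zeta 1) x = eigenFnRaw l lam x := by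
  simp only [eigenFnRaw, solOne_mul_zeta, solTwo_mul_zeta]

lemma eigenFn_mul_zeta (l : ℝ) (lam : ℂ) (x : ℝ) :
    eigenFn l (lam * zeta 1) x = eigenFn l lam x := by
  simp only [eigenFn, normConst, eigenFnRaw_mul_zeta]

/-- The characteristic function depends only on `λ³`. -/
lemma charFn_eq_of_cube_eq (l : ℝ) (θ : ℂ) {a b : ℂ} (h : a ^ 3 = b ^ 3) :
    charFn l θ a = charFn l θ b := by
  -- Factorization of `a³ - b³` over the cube roots of unity.
  have hf : (a - b) * ((a - b * zeta 1) * (a - b * zeta 1 * zeta 1)) = 0 := by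
    linear_combination h + (a * b ^ 2 * zeta 1 - a ^ 2 * b) * zeta_one_quadratic
      - b ^ 3 * zeta_one_cube
  rcases mul_eq_zero.1 hf with h1 | h1
  · rw [sub_eq_zero.1 h1]
  rcases mul_eq_zero.1 h1 with h1 | h1
  · rw [sub_eq_zero.1 h1, charFn_mul_zeta]
  · rw [sub_eq_zero.1 h1, charFn_mul_zeta, charFn_mul_zeta]

/-! ### Absolutely continuous functions -/

lemma AbsolutelyContinuousOnInterval.of_dist_le {X Y : Type*} [PseudoMetricSpace X]
    [PseudoMetricSpace Y] {f : ℝ → X} {g : ℝ → Y} {a b : ℝ}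
    (hg : AbsolutelyContinuousOnInterval g a b)
    (h : ∀ x ∈ uIcc a b, ∀ y ∈ uIcc a b, dist (f x) (f y) ≤ dist (g x) (g y)) :
    AbsolutelyContinuousOnInterval f a b := by
  rw [absolutelyContinuousOnInterval_iff] at hg ⊢
  intro ε hε
  obtain ⟨δ, hδ, H⟩ := hg ε hε
  refine ⟨δ, hδ, fun E hE hlt => lt_of_le_of_lt (Finset.sum_le_sum fun i hi => ?_) (H E hE hlt)⟩
  exact h _ (hE.1 i hi).1 _ (hE.1 i hi).2

/-- Increments of the integral are dominated by those of the integral of `‖g‖`, which reduces the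
complex case to the real one. -/
lemma absolutelyContinuousOnInterval_integral {g : ℝ → ℂ} {a b : ℝ} (hab : a ≤ b)
    (hg : IntervalIntegrable g volume a b) :
    AbsolutelyContinuousOnInterval (fun x => ∫ t in a..x, g t) a b := by
  refine (hg.norm.absolutelyContinuousOnInterval_intervalIntegral (c := a) (by simp)).of_dist_le ?_
  intro x hx y hy
  rw [uIcc_of_le hab] at hx hy
  have hsub : ∀ z ∈ Icc a b, IntervalIntegrable g volume a z := fun z hz =>
    hg.mono_set (by rw [uIcc_of_le hab, uIcc_of_le hz.1]; exact Icc_subset_Icc_right hz.2)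
  rw [dist_eq_norm, Real.dist_eq, intervalIntegral.integral_interval_sub_left (hsub x hx) (hsub y hy),
    intervalIntegral.integral_interval_sub_left (hsub x hx).norm (hsub y hy).norm]
  exact intervalIntegral.norm_integral_le_abs_integral_norm

/-- The fundamental theorem of calculus for complex absolutely continuous functions. -/
lemma AbsolutelyContinuousOnInterval.integral_eq_sub_of_ae_hasDerivAt {f g : ℝ → ℂ} {a b : ℝ}
    (hab : a ≤ b) (hf : AbsolutelyContinuousOnInterval f a b)
    (hg : IntervalIntegrable g volume a b)
    (h : ∀ᵐ x ∂volume.restrict (Ioo a b), HasDerivAt f (g x) x) :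
    ∫ x in a..b, g x = f b - f a := by
  -- The difference of `f` and the primitive of `g` is absolutely continuous with derivative zero
  -- almost everywhere, hence constant.
  have hac := hf.fun_sub (absolutelyContinuousOnInterval_integral hab hg)
  have h0 : ∀ᵐ x, x ∈ uIcc a b → HasDerivAt (fun x => f x - ∫ t in a..x, g t) 0 x := by
    have h' : ∀ᵐ x ∂volume.restrict (Icc a b), HasDerivAt f (g x) x := by
      rwa [← restrict_Ioo_eq_restrict_Icc]
    rw [ae_restrict_iff' measurableSet_Icc] at h'
    filter_upwards [h', hg.ae_hasDerivAt_integral] with x h1 h2 hx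
    have := (h1 (by rwa [uIcc_of_le hab] at hx)).sub (h2 hx a (by simp))
    rwa [sub_self] at this
  obtain ⟨C, hC⟩ := hac.const_of_ae_hasDerivAt_zero h0
  have h1 := hC a (by simp)
  have h2 := hC b (by simp)
  simp only [intervalIntegral.integral_same, sub_zero] at h1
  rw [h1, ← h2]
  ring

lemma absolutelyContinuousOnInterval_of_hasDerivWithinAt {f g : ℝ → ℂ} {a b : ℝ} (hab : a ≤ b)
    (hf : ∀ x ∈ Icc a b, HasDerivWithinAt f (g x) (Icc a b) x) (hg : ContinuousOn g (Icc a b)) :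
    AbsolutelyContinuousOnInterval f a b := by
  obtain ⟨C, hC⟩ := isCompact_Icc.exists_bound_of_continuousOn hg
  have hC0 : 0 ≤ C := (norm_nonneg _).trans (hC a (left_mem_Icc.2 hab))
  have : LipschitzOnWith ⟨C, hC0⟩ f (uIcc a b) := by
    rw [uIcc_of_le hab]
    exact (convex_Icc a b).lipschitzOnWith_of_nnnorm_hasDerivWithin_le hf fun x hx => hC x hx
  exact this.absolutelyContinuousOnInterval

lemma AbsolutelyContinuousOnInterval.star {f : ℝ → ℂ} {a b : ℝ}
    (hf : AbsolutelyContinuousOnInterval f a b) :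
    AbsolutelyContinuousOnInterval (fun x => star (f x)) a b :=
  hf.of_dist_le fun x _ y _ => by rw [dist_star_star]

/-! ### The Sobolev space -/

lemma memLp_of_continuous {l : ℝ} {f : ℝ → ℂ} (hf : Continuous f) :
    MemLp f 2 (volume.restrict (Ioo (0 : ℝ) l)) := by
  obtain ⟨C, hC⟩ := isCompact_Icc.exists_bound_of_continuousOn (hf.continuousOn (s := Icc 0 l))
  refine MemLp.of_bound hf.aestronglyMeasurable C ?_
  filter_upwards [ae_restrict_mem measurableSet_Ioo] with x hx using hC x (Ioo_subset_Icc_self hx)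

namespace IsSobolevThree

variable {l : ℝ} {y y₁ y₂ y₃ z z₁ z₂ z₃ : ℝ → ℂ}

lemma add (hy : IsSobolevThree l y y₁ y₂ y₃) (hz : IsSobolevThree l z z₁ z₂ z₃) :
    IsSobolevThree l (y + z) (y₁ + z₁) (y₂ + z₂) (y₃ + z₃) where
  hasDeriv_zero x hx := (hy.hasDeriv_zero x hx).add (hz.hasDeriv_zero x hx)
  hasDeriv_one x hx := (hy.hasDeriv_one x hx).add (hz.hasDeriv_one x hx)
  absCont := hy.absCont.add hz.absCont
  ae_hasDeriv := by
    filter_upwards [hy.ae_hasDeriv, hz.ae_hasDeriv] with x h h' using h.add h'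
  memLp := hy.memLp.add hz.memLp

lemma continuousOn_zero (hy : IsSobolevThree l y y₁ y₂ y₃) : ContinuousOn y (Icc 0 l) :=
  fun x hx => (hy.hasDeriv_zero x hx).continuousWithinAt

lemma continuousOn_one (hy : IsSobolevThree l y y₁ y₂ y₃) : ContinuousOn y₁ (Icc 0 l) :=
  fun x hx => (hy.hasDeriv_one x hx).continuousWithinAt

lemma continuousOn_two (hl : 0 ≤ l) (hy : IsSobolevThree l y y₁ y₂ y₃) :
    ContinuousOn y₂ (Icc 0 l) := by
  have := hy.absCont.continuousOn
  rwa [uIcc_of_le hl] at this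

lemma absCont_zero (hl : 0 ≤ l) (hy : IsSobolevThree l y y₁ y₂ y₃) :
    AbsolutelyContinuousOnInterval y 0 l :=
  absolutelyContinuousOnInterval_of_hasDerivWithinAt hl hy.hasDeriv_zero hy.continuousOn_one

lemma absCont_one (hl : 0 ≤ l) (hy : IsSobolevThree l y y₁ y₂ y₃) :
    AbsolutelyContinuousOnInterval y₁ 0 l :=
  absolutelyContinuousOnInterval_of_hasDerivWithinAt hl hy.hasDeriv_one (hy.continuousOn_two hl)

lemma ae_hasDerivAt_all (hy : IsSobolevThree l y y₁ y₂ y₃) :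
    ∀ᵐ x ∂volume.restrict (Ioo (0 : ℝ) l), HasDerivAt y (y₁ x) x ∧ HasDerivAt y₁ (y₂ x) x ∧
      HasDerivAt y₂ (y₃ x) x := by
  filter_upwards [hy.ae_hasDeriv, ae_restrict_mem measurableSet_Ioo] with x h hx
  exact ⟨(hy.hasDeriv_zero x (Ioo_subset_Icc_self hx)).hasDerivAt (Icc_mem_nhds hx.1 hx.2),
    (hy.hasDeriv_one x (Ioo_subset_Icc_self hx)).hasDerivAt (Icc_mem_nhds hx.1 hx.2), h⟩

/-- A function in `W₂³` solving `y''' = (iλ)³ y` is a combination of the fundamental system. -/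
lemma eq_sol (lam : ℂ) (hy : IsSobolevThree l y y₁ y₂ y₃)
    (h : ∀ᵐ x ∂volume.restrict (Ioo (0 : ℝ) l), y₃ x = (Complex.I * lam) ^ 3 * y x) :
    ∀ x ∈ Icc 0 l, y x = y 0 * solZero lam x + y₁ 0 * solOne lam x + y₂ 0 * solTwo lam x := by
  intro x hx
  have hl : 0 ≤ l := hx.1.trans hx.2
  have shift : ∀ f f' : ℝ → ℂ, (∀ t, HasDerivAt f (f' t) t) → ∀ t,
      HasDerivAt (fun t => f (x - t)) (-f' (x - t)) t := by
    intro f f' hf t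
    have := (hf (x - t)).scomp t ((hasDerivAt_id t).const_sub x)
    simpa [Function.comp_def] using! this
  have d0 := shift _ _ (hasDerivAt_solZero lam)
  have d1 := shift _ _ (hasDerivAt_solOne lam)
  have d2 := shift _ _ (hasDerivAt_solTwo lam)
  have ac : ∀ f f' : ℝ → ℂ, (∀ t, HasDerivAt f (f' t) t) → Continuous f' →
      AbsolutelyContinuousOnInterval f 0 l := fun f f' hf hc =>
    absolutelyContinuousOnInterval_of_hasDerivWithinAt hl (fun t _ => (hf t).hasDerivWithinAt)
      hc.continuousOn
  have hsub : Continuous fun t : ℝ => x - t := by fun_prop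
  have a0 := ac _ _ d0
    ((continuous_const.mul (continuous_solTwo lam)).comp hsub).neg
  have a1 := ac _ _ d1 ((continuous_solZero lam).comp hsub).neg
  have a2 := ac _ _ d2 ((continuous_solOne lam).comp hsub).neg
  -- The function `y₂(t) S₂(x-t) + y₁(t) S₁(x-t) + y(t) S₀(x-t)` has derivative `(y₃ - (iλ)³ y)
  -- S₂(x-t) = 0`. Its values at `t = x` and `t = 0` are the two sides of the claim.
  have hW := ((hy.absCont.fun_smul a2).fun_add ((hy.absCont_one hl).fun_smul a1)).fun_add
    ((hy.absCont_zero hl).fun_smul a0)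
  have hint := AbsolutelyContinuousOnInterval.integral_eq_sub_of_ae_hasDerivAt (g := fun _ => 0)
    hx.1 (hW.mono (c := 0) (d := x) (by
      rw [uIcc_of_le hl, uIcc_of_le hx.1]; exact Icc_subset_Icc_right hx.2)) (by simp) (by
      have hall := ae_restrict_of_ae_restrict_of_subset (Ioo_subset_Ioo_right hx.2)
        (hy.ae_hasDerivAt_all.and h)
      filter_upwards [hall] with t ht
      obtain ⟨⟨e0, e1, e2⟩, e3⟩ := ht
      refine (((e2.fun_smul (d2 t)).fun_add (e1.fun_smul (d1 t))).fun_add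
        (e0.fun_smul (d0 t))).congr_deriv ?_
      simp only [smul_eq_mul, e3]
      ring)
  simp only [intervalIntegral.integral_zero, sub_self, sub_zero, solZero_zero, solOne_zero,
    solTwo_zero, smul_eq_mul, mul_zero, mul_one, zero_add] at hint
  linear_combination -hint

/-- Lagrange's identity for `y ↦ y'''`. -/
lemma integral_lagrange (hl : 0 ≤ l) (hy : IsSobolevThree l y y₁ y₂ y₃)
    (hz : IsSobolevThree l z z₁ z₂ z₃)
    (hint : IntervalIntegrable (fun x => star (y₃ x) * z x + star (y x) * z₃ x) volume 0 l) :
    ∫ x in (0 : ℝ)..l, (star (y₃ x) * z x + star (y x) * z₃ x) =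
      (star (y₂ l) * z l - star (y₁ l) * z₁ l + star (y l) * z₂ l) -
      (star (y₂ 0) * z 0 - star (y₁ 0) * z₁ 0 + star (y 0) * z₂ 0) := by
  -- With alternating signs the mixed products cancel in the derivative of this bilinear form.
  have hW := ((hy.absCont.star.fun_smul (hz.absCont_zero hl)).fun_sub
    ((hy.absCont_one hl).star.fun_smul (hz.absCont_one hl))).fun_add
    ((hy.absCont_zero hl).star.fun_smul hz.absCont)
  refine hW.integral_eq_sub_of_ae_hasDerivAt hl hint ?_
  filter_upwards [hy.ae_hasDerivAt_all, hz.ae_hasDerivAt_all] with x ⟨d0, d1, d2⟩ ⟨e0, e1, e2⟩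
  refine (((d2.star.fun_smul e0).fun_sub (d1.star.fun_smul e1)).fun_add
    (d0.star.fun_smul e2)).congr_deriv ?_
  simp only [smul_eq_mul]
  ring

lemma of_hasDerivAt (h0 : ∀ x, HasDerivAt y (y₁ x) x) (h1 : ∀ x, HasDerivAt y₁ (y₂ x) x)
    (h2 : ∀ x, HasDerivAt y₂ (y₃ x) x) (hc : Continuous y₃) (hl : 0 ≤ l) :
    IsSobolevThree l y y₁ y₂ y₃ where
  hasDeriv_zero x _ := (h0 x).hasDerivWithinAt
  hasDeriv_one x _ := (h1 x).hasDerivWithinAt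
  absCont := absolutelyContinuousOnInterval_of_hasDerivWithinAt hl
    (fun x _ => (h2 x).hasDerivWithinAt) hc.continuousOn
  ae_hasDeriv := Filter.Eventually.of_forall h2
  memLp := memLp_of_continuous hc

lemma sol (hl : 0 ≤ l) (lam a b : ℂ) : IsSobolevThree l
    (fun x => a * solOne lam x + b * solTwo lam x) (fun x => a * solZero lam x + b * solOne lam x)
    (fun x => a * ((Complex.I * lam) ^ 3 * solTwo lam x) + b * solZero lam x)
    (fun x => (Complex.I * lam) ^ 3 * (a * solOne lam x + b * solTwo lam x)) := by
  refine of_hasDerivAt (fun x => ?_) (fun x => ?_) (fun x => ?_) ?_ hl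
  · exact ((hasDerivAt_solOne lam x).const_mul a).fun_add ((hasDerivAt_solTwo lam x).const_mul b)
  · exact ((hasDerivAt_solZero lam x).const_mul a).fun_add ((hasDerivAt_solOne lam x).const_mul b)
  · refine ((((hasDerivAt_solTwo lam x).const_mul _).const_mul a).fun_add
      ((hasDerivAt_solZero lam x).const_mul b)).congr_deriv ?_
    ring
  · have := continuous_solOne lam
    have := continuous_solTwo lam
    fun_prop

/-- Variation of constants: the inhomogeneous equation `y''' = (iλ)³ y + g` is solvable. -/
lemma exists_particular (hl : 0 ≤ l) (lam : ℂ) {g : ℝ → ℂ}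
    (hg : MemLp g 2 (volume.restrict (Ioo (0 : ℝ) l))) :
    ∃ y y₁ y₂ y₃ : ℝ → ℂ, IsSobolevThree l y y₁ y₂ y₃ ∧ y 0 = 0 ∧ y₁ 0 = 0 ∧
      ∀ᵐ x ∂volume.restrict (Ioo (0 : ℝ) l), y₃ x = (Complex.I * lam) ^ 3 * y x + g x := by
  set κ := (Complex.I * lam) ^ 3 with hκ
  set g₀ : ℝ → ℂ := (Ioo 0 l).indicator g with hg₀
  have hgi : Integrable g₀ :=
    (integrable_indicator_iff measurableSet_Ioo).2 (hg.integrable (by norm_num))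
  have hae : ∀ᵐ x ∂volume.restrict (Ioo (0 : ℝ) l), g₀ x = g x := by
    filter_upwards [ae_restrict_mem measurableSet_Ioo] with x hx using indicator_of_mem hx g
  -- Working with the primitive `G` instead of `g` keeps the integrands below continuous, so the
  -- `J`'s are differentiable everywhere.
  set G : ℝ → ℂ := fun x => ∫ t in (0 : ℝ)..x, g₀ t with hG
  have hGc : Continuous G := hgi.continuous_primitive 0
  have prim : ∀ s : ℝ → ℂ, Continuous s → ∀ x : ℝ,
      HasDerivAt (fun x => ∫ t in (0 : ℝ)..x, s (-t) * G t) (s (-x) * G x) x := fun s hs x =>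
    (((hs.comp continuous_neg).mul hGc).integral_hasStrictDerivAt 0 x).hasDerivAt
  set A : ℝ → ℂ := fun x => ∫ t in (0 : ℝ)..x, solZero lam (-t) * G t
  set B : ℝ → ℂ := fun x => ∫ t in (0 : ℝ)..x, solOne lam (-t) * G t
  set C : ℝ → ℂ := fun x => ∫ t in (0 : ℝ)..x, solTwo lam (-t) * G t
  have dA : ∀ x, HasDerivAt A (solZero lam (-x) * G x) x := prim _ (continuous_solZero lam)
  have dB : ∀ x, HasDerivAt B (solOne lam (-x) * G x) x := prim _ (continuous_solOne lam)
  have dC : ∀ x, HasDerivAt C (solTwo lam (-x) * G x) x := prim _ (continuous_solTwo lam)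
  have s0 := hasDerivAt_solZero lam
  have s1 := hasDerivAt_solOne lam
  have s2 := hasDerivAt_solTwo lam
  -- `J_p` is the convolution of `S_p` with `G`, split by the addition formulas. The solution is
  -- `J₁`, the integration by parts of the convolution of `S₂` with `g`.
  set J₂ : ℝ → ℂ := fun x => solTwo lam x * A x + solOne lam x * B x + solZero lam x * C x
  set J₁ : ℝ → ℂ := fun x =>
    solOne lam x * A x + solZero lam x * B x + κ * (solTwo lam x * C x)
  set J₀ : ℝ → ℂ := fun x =>
    solZero lam x * A x + κ * (solOne lam x * C x + solTwo lam x * B x)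
  have dJ₂ : ∀ x, HasDerivAt J₂ (J₁ x) x := by
    intro x
    have h := solTwo_sub lam x x
    rw [sub_self, solTwo_zero] at h
    refine ((((s2 x).fun_mul (dA x)).fun_add ((s1 x).fun_mul (dB x))).fun_add
      ((s0 x).fun_mul (dC x))).congr_deriv ?_
    simp only [J₁]
    linear_combination -G x * h
  have dJ₁ : ∀ x, HasDerivAt J₁ (J₀ x) x := by
    intro x
    have h := solOne_sub lam x x
    rw [sub_self, solOne_zero] at h
    refine ((((s1 x).fun_mul (dA x)).fun_add ((s0 x).fun_mul (dB x))).fun_add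
      (((s2 x).fun_mul (dC x)).const_mul κ)).congr_deriv ?_
    simp only [J₀]
    linear_combination -G x * h
  have dJ₀ : ∀ x, HasDerivAt J₀ (κ * J₂ x + G x) x := by
    intro x
    have h := solZero_sub lam x x
    rw [sub_self, solZero_zero] at h
    refine (((s0 x).fun_mul (dA x)).fun_add
      ((((s1 x).fun_mul (dC x)).fun_add ((s2 x).fun_mul (dB x))).const_mul κ)).congr_deriv ?_
    simp only [J₂]
    linear_combination -G x * h
  have cJ₁ : Continuous J₁ := continuous_iff_continuousAt.2 fun x => (dJ₁ x).continuousAt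
  refine ⟨J₁, J₀, fun x => κ * J₂ x + G x, fun x => κ * J₁ x + g₀ x, ⟨?_, ?_, ?_, ?_, ?_⟩,
    by simp [J₁, A, B, C], by simp [J₀, A, B, C], ?_⟩
  · exact fun x _ => (dJ₁ x).hasDerivWithinAt
  · exact fun x _ => (dJ₀ x).hasDerivWithinAt
  · refine AbsolutelyContinuousOnInterval.fun_add ?_
      (absolutelyContinuousOnInterval_integral hl hgi.intervalIntegrable)
    exact absolutelyContinuousOnInterval_of_hasDerivWithinAt hl
      (fun x _ => ((dJ₂ x).const_mul κ).hasDerivWithinAt) (continuous_const.mul cJ₁).continuousOn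
  · filter_upwards [ae_restrict_of_ae
      (LocallyIntegrable.ae_hasDerivAt_integral hgi.locallyIntegrable)] with x hx
    exact ((dJ₂ x).const_mul κ).fun_add (hx 0)
  · exact (memLp_of_continuous (continuous_const.mul cJ₁)).add
      (hg.ae_eq (by filter_upwards [hae] with x hx using hx.symm))
  · filter_upwards [hae] with x hx
    rw [hx]

end IsSobolevThree

/-! ### Real zeros of the characteristic function -/

lemma differentiable_trigS_two : Differentiable ℂ (trigS 2) :=
  fun z => (hasDerivAt_trigS_succ 1 z).differentiableAt

lemma continuous_trigS_two : Continuous (trigS 2) := differentiable_trigS_two.continuous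

lemma star_zeta_one : star (zeta 1) = zeta 1 ^ 2 := by
  rw [← zeta_two]
  simp [zeta, Complex.conj_ofReal, sub_eq_add_neg]

lemma norm_zeta_one : ‖zeta 1‖ = 1 :=
  (pow_eq_one_iff_of_nonneg (norm_nonneg _) three_ne_zero).1 (by
    rw [← norm_pow, zeta_one_cube, norm_one])

/-- Conjugation exchanges `ζ` with `ζ²` and changes the sign of `it`. -/
lemma star_trigS_two (t : ℝ) :
    star (trigS 2 (Complex.I * t)) = trigS 2 (-(Complex.I * t)) := by
  have h4 : zeta 1 ^ 4 = zeta 1 := by linear_combination zeta 1 * zeta_one_cube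
  have hexp : ∀ z : ℂ, star (Complex.exp z) = Complex.exp (star z) := fun z =>
    (Complex.exp_conj z).symm
  have hI : star (Complex.I * (t : ℂ)) = -(Complex.I * t) := by simp
  simp only [trigS_two_eq, star_div₀, star_add, star_mul', star_pow, hexp, star_zeta_one, hI,
    ← pow_mul, Nat.reduceMul, h4, star_ofNat]
  ring

lemma exp_I_mul_zeta (t : ℝ) : Complex.exp (Complex.I * t * zeta 1) =
    (Real.exp (-(Real.sqrt 3 / 2 * t)) : ℂ) * Complex.exp (((-t / 2 : ℝ) : ℂ) * Complex.I) := by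
  rw [Complex.ofReal_exp, ← Complex.exp_add]
  congr 1
  simp only [zeta, Matrix.cons_val_one, Matrix.cons_val_zero]
  push_cast
  linear_combination (1 / 2 : ℂ) * t * (Real.sqrt 3 : ℝ) * Complex.I_sq

lemma exp_I_mul_zeta_sq (t : ℝ) : Complex.exp (Complex.I * t * zeta 1 ^ 2) =
    (Real.exp (Real.sqrt 3 / 2 * t) : ℂ) * Complex.exp (((-t / 2 : ℝ) : ℂ) * Complex.I) := by
  rw [Complex.ofReal_exp, ← Complex.exp_add, ← zeta_two]
  congr 1
  simp only [zeta, Matrix.cons_val]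
  push_cast
  linear_combination (-1 / 2 : ℂ) * t * (Real.sqrt 3 : ℝ) * Complex.I_sq

/-- A continuous function that differs by a bounded amount from an oscillating exponential has
arbitrarily large zeros. -/
lemma exists_zero_gt_of_oscillating {F : ℝ → ℝ} (hF : Continuous F) (β : ℝ)
    (h : ∀ t, 0 ≤ t → |F t - Real.exp (Real.sqrt 3 / 2 * t) * Real.cos (β - t / 2)| ≤ 2) (M : ℝ) :
    ∃ s t, M < t ∧ F t = 0 ∧ 0 < F s := by
  -- At `t₀ = 2β + 4πn` the cosine is `1`, and at `t₀ + 2π` it is `-1`; `n` is chosen to make `t₀`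
  -- exceed both `M` and `2`. Beyond `2` the amplitude beats the error bound.
  obtain ⟨n, hn⟩ := exists_nat_gt ((max M 2 - 2 * β) / (4 * Real.pi))
  have hpi := Real.pi_pos
  rw [div_lt_iff₀ (by positivity)] at hn
  set t₀ := 2 * β + n * (4 * Real.pi) with ht₀
  have hM : M < t₀ := by linarith [le_max_left M 2]
  have h2 : 2 < t₀ := by linarith [le_max_right M 2]
  have big : ∀ t, 2 < t → 2 < Real.exp (Real.sqrt 3 / 2 * t) := by
    intro t ht
    have h3 : 1 ≤ Real.sqrt 3 := Real.one_le_sqrt.2 (by norm_num)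
    have := Real.add_one_le_exp (Real.sqrt 3 / 2 * t)
    nlinarith
  have c0 : Real.cos (β - t₀ / 2) = 1 := by
    have : β - t₀ / 2 = -(n * (2 * Real.pi)) := by rw [ht₀]; ring
    rw [this, Real.cos_neg, Real.cos_nat_mul_two_pi]
  have c1 : Real.cos (β - (t₀ + 2 * Real.pi) / 2) = -1 := by
    have : β - (t₀ + 2 * Real.pi) / 2 = -(n * (2 * Real.pi) + Real.pi) := by rw [ht₀]; ring
    rw [this, Real.cos_neg, Real.cos_nat_mul_two_pi_add_pi]
  have p0 : 0 < F t₀ := by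
    have := h t₀ (by linarith)
    rw [c0, abs_le] at this
    linarith [big t₀ h2, this.1]
  have p1 : F (t₀ + 2 * Real.pi) < 0 := by
    have := h (t₀ + 2 * Real.pi) (by linarith)
    rw [c1, abs_le] at this
    linarith [big (t₀ + 2 * Real.pi) (by linarith), this.2]
  obtain ⟨t, ht, hFt⟩ := intermediate_value_Icc' (by linarith : t₀ ≤ t₀ + 2 * Real.pi)
    hF.continuousOn ⟨p1.le, p0.le⟩
  exact ⟨t₀, t, by linarith [ht.1], hFt, p0⟩

/-- The real function whose zeros are those of `θ s₂(it) + s₂(-it)`, where `c² = θ`. -/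
noncomputable def realChar (c : ℂ) (t : ℝ) : ℝ := (3 * (c * trigS 2 (Complex.I * t))).re

lemma continuous_realChar (c : ℂ) : Continuous (realChar c) := by
  have := continuous_trigS_two
  unfold realChar
  fun_prop

/-- As `c` is unimodular, `c² s + s̄ = c (cs + conj(cs))`, which is `c` times a real number. -/
lemma realChar_eq {c : ℂ} (hc : ‖c‖ = 1) (t : ℝ) : (c ^ 2 * trigS 2 (Complex.I * t)
    + trigS 2 (-(Complex.I * t))) = 2 / 3 * c * (realChar c t : ℂ) := by
  rw [realChar, Complex.re_eq_add_conj, ← star_trigS_two]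
  have hcc : c * star c = 1 := by
    have := Complex.mul_conj c
    rw [Complex.normSq_eq_norm_sq, hc] at this
    simpa using this
  have hstar : (starRingEnd ℂ) (3 * (c * trigS 2 (Complex.I * t))) =
      3 * (star c * star (trigS 2 (Complex.I * t))) := by
    simp [map_ofNat]
  rw [hstar]
  linear_combination -star (trigS 2 (Complex.I * t)) * hcc

lemma re_mul_exp_eq {d : ℂ} (hd : ‖d‖ = 1) (r t : ℝ) :
    (d * ((r : ℂ) * Complex.exp (((-t / 2 : ℝ) : ℂ) * Complex.I))).re =
      r * Real.cos (d.arg - t / 2) := by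
  have hd' : d = Complex.exp (d.arg * Complex.I) := by
    have := Complex.norm_mul_exp_arg_mul_I d
    rw [hd] at this
    simpa using this.symm
  have : d * ((r : ℂ) * Complex.exp (((-t / 2 : ℝ) : ℂ) * Complex.I)) =
      (r : ℂ) * Complex.exp (((d.arg - t / 2 : ℝ) : ℂ) * Complex.I) := by
    conv_lhs => rw [hd']
    rw [mul_left_comm, ← Complex.exp_add]
    congr 2
    push_cast
    ring
  rw [this, Complex.re_ofReal_mul, Complex.exp_ofReal_mul_I_re]

/-- One term is bounded, one decays and one grows; the last two trade roles when `t` changes sign.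
-/
lemma realChar_expand {c : ℂ} (hc : ‖c‖ = 1) (t : ℝ) : realChar c t =
    (c * Complex.exp (Complex.I * t)).re
      + Real.exp (-(Real.sqrt 3 / 2 * t)) * Real.cos ((c * zeta 1).arg - t / 2)
      + Real.exp (Real.sqrt 3 / 2 * t) * Real.cos ((c * zeta 1 ^ 2).arg - t / 2) := by
  rw [← re_mul_exp_eq (by simp [hc, norm_zeta_one]), ← re_mul_exp_eq (by simp [hc, norm_zeta_one]),
    ← exp_I_mul_zeta, ← exp_I_mul_zeta_sq, ← Complex.add_re, ← Complex.add_re, realChar,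
    trigS_two_eq]
  congr 1
  ring

lemma abs_re_mul_exp_le {c : ℂ} (hc : ‖c‖ = 1) (t : ℝ) :
    |(c * Complex.exp (Complex.I * t)).re| ≤ 1 := by
  refine (Complex.abs_re_le_norm _).trans ?_
  rw [norm_mul, hc, mul_comm Complex.I, Complex.norm_exp_ofReal_mul_I, one_mul]

lemma abs_exp_mul_cos_le {a b : ℝ} (ha : 0 ≤ a) : |Real.exp (-a) * Real.cos b| ≤ 1 := by
  rw [abs_mul, abs_of_pos (Real.exp_pos _)]
  exact mul_le_one₀ (Real.exp_le_one_iff.2 (by linarith)) (abs_nonneg _) (Real.abs_cos_le_one b)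

/-- The point `s` of positivity serves to show that the function is not identically zero. -/
lemma exists_realChar_zero_gt {c : ℂ} (hc : ‖c‖ = 1) (M : ℝ) :
    ∃ s t, M < t ∧ realChar c t = 0 ∧ 0 < realChar c s := by
  refine exists_zero_gt_of_oscillating (continuous_realChar c) (c * zeta 1 ^ 2).arg ?_ M
  intro t ht
  rw [realChar_expand hc, add_sub_cancel_right]
  have h1 := abs_re_mul_exp_le hc t
  have h2 := abs_exp_mul_cos_le (a := Real.sqrt 3 / 2 * t) (b := (c * zeta 1).arg - t / 2)
    (by positivity)
  exact (abs_add_le _ _).trans (by linarith)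

lemma exists_realChar_zero_lt {c : ℂ} (hc : ‖c‖ = 1) (M : ℝ) :
    ∃ t, t < M ∧ realChar c t = 0 := by
  obtain ⟨-, t, ht, h0, -⟩ := exists_zero_gt_of_oscillating
    (F := fun t => realChar c (-t)) ((continuous_realChar c).comp continuous_neg)
    (-(c * zeta 1).arg) (by
      intro t ht
      have e1 : (c * zeta 1).arg - -t / 2 = -(-(c * zeta 1).arg - t / 2) := by ring
      have e2 : -(Real.sqrt 3 / 2 * -t) = Real.sqrt 3 / 2 * t := by ring
      have e3 : Real.sqrt 3 / 2 * -t = -(Real.sqrt 3 / 2 * t) := by ring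
      rw [realChar_expand hc, e1, Real.cos_neg, e2, e3]
      have h1 := abs_re_mul_exp_le hc (-t)
      have h2 := abs_exp_mul_cos_le (a := Real.sqrt 3 / 2 * t)
        (b := (c * zeta 1 ^ 2).arg - -t / 2) (by positivity)
      have := abs_add_le (c * Complex.exp (Complex.I * ((-t : ℝ) : ℂ))).re
        (Real.exp (-(Real.sqrt 3 / 2 * t)) * Real.cos ((c * zeta 1 ^ 2).arg - -t / 2))
      rw [add_right_comm, add_sub_cancel_right]
      linarith) (-M)
  exact ⟨-t, by linarith, h0⟩

/-- The origin is excluded because `realChar` always vanishes there, while `charFn` need not. -/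
lemma charFn_ofReal_eq_zero_iff {l : ℝ} {c : ℂ} (hc : ‖c‖ = 1) {x : ℝ} (hx : x ≠ 0) :
    charFn l (c ^ 2) x = 0 ↔ realChar c (x * l) = 0 := by
  have hc0 : c ≠ 0 := by rintro rfl; simp at hc
  have e : Complex.I * (x : ℂ) * l = Complex.I * ((x * l : ℝ) : ℂ) := by push_cast; ring
  rw [charFn, if_neg (by exact_mod_cast hx), e, realChar_eq hc]
  simp [hx, hc0]

/-- Infinitely many zeros in a compact interval would accumulate, and the identity theorem would
make the numerator `h` vanish identically. Using `h` avoids the removable singularity. -/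
lemma finite_charFn_zeros {l : ℝ} (hl : 0 < l) {c : ℂ} (hc : ‖c‖ = 1) (a b : ℝ) :
    {x : ℝ | x ∈ Icc a b ∧ charFn l (c ^ 2) x = 0}.Finite := by
  have hc0 : c ≠ 0 := by rintro rfl; simp at hc
  set h : ℂ → ℂ := fun z => c ^ 2 * trigS 2 (Complex.I * (z * l)) + trigS 2 (-(Complex.I * (z * l)))
    with hh
  have hval : ∀ x : ℝ, h x = 2 / 3 * c * (realChar c (x * l) : ℂ) := by
    intro x
    rw [← realChar_eq hc, hh]
    push_cast
    rfl
  have hd : Differentiable ℂ h := by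
    have := differentiable_trigS_two
    fun_prop
  by_contra hinf
  have hinf' : (Complex.ofReal '' {x : ℝ | x ∈ Icc a b ∧ charFn l (c ^ 2) x = 0}).Infinite :=
    Set.Infinite.image Complex.ofReal_injective.injOn hinf
  obtain ⟨z, -, hz⟩ := hinf'.exists_accPt_of_subset_isCompact
    ((isCompact_Icc (a := a) (b := b)).image Complex.continuous_ofReal)
    (image_mono fun x hx => hx.1)
  have hfreq : ∃ᶠ w in nhdsWithin z {z}ᶜ, h w = 0 := by
    refine (accPt_iff_frequently_nhdsNE.1 hz).mono ?_
    rintro _ ⟨x, ⟨-, hx⟩, rfl⟩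
    rw [hval]
    by_cases hx0 : x = 0
    · have : realChar c 0 = 0 := by simp [realChar, trigS_two_zero]
      simp [hx0, this]
    · rw [charFn_ofReal_eq_zero_iff hc hx0] at hx
      simp [hx]
  have hzero := AnalyticOnNhd.eqOn_zero_of_preconnected_of_frequently_eq_zero
    (U := univ) (fun w _ => hd.analyticAt w) isPreconnected_univ (mem_univ z) hfreq
  obtain ⟨s, -, -, -, hs⟩ := exists_realChar_zero_gt hc 0
  have := hzero (mem_univ ((s / l : ℝ) : ℂ))
  rw [hval, div_mul_cancel₀ _ hl.ne'] at this
  simp [hc0, hs.ne'] at this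

/-- A set of reals that is locally finite and unbounded in both directions is the range of a
strictly increasing two-sided sequence. -/
lemma exists_strictMono_int_range_eq {S : Set ℝ} (hfin : ∀ a b, {x | x ∈ Icc a b ∧ x ∈ S}.Finite)
    (hup : ∀ M, ∃ x ∈ S, M < x) (hdown : ∀ M, ∃ x ∈ S, x < M) :
    ∃ u : ℤ → ℝ, StrictMono u ∧ range u = S := by
  classical
  -- A nonempty, locally finite linear order without endpoints is order isomorphic to `ℤ`.
  let _ : LocallyFiniteOrder S := LocallyFiniteOrder.ofFiniteIcc fun a b =>
    Set.Finite.of_finite_image ((hfin a b).subset (by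
      rintro _ ⟨x, hx, rfl⟩
      exact ⟨⟨hx.1, hx.2⟩, x.2⟩)) Subtype.val_injective.injOn
  have : NoMaxOrder S := ⟨fun a => by
    obtain ⟨x, hx, h⟩ := hup a
    exact ⟨⟨x, hx⟩, h⟩⟩
  have : NoMinOrder S := ⟨fun a => by
    obtain ⟨x, hx, h⟩ := hdown a
    exact ⟨⟨x, hx⟩, h⟩⟩
  have : Nonempty S := by
    obtain ⟨x, hx, -⟩ := hup 0
    exact ⟨⟨x, hx⟩⟩
  let _ : SuccOrder S := LinearLocallyFiniteOrder.succOrder S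
  let _ : PredOrder S := LinearLocallyFiniteOrder.predOrder S
  let e : S ≃o ℤ := orderIsoIntOfLinearSuccPredArch
  refine ⟨fun n => (e.symm n : ℝ), fun m n h => e.symm.strictMono h, ?_⟩
  ext x
  constructor
  · rintro ⟨n, rfl⟩
    exact (e.symm n).2
  · intro hx
    exact ⟨e ⟨x, hx⟩, by simp⟩

lemma exists_strictMono_charFn_zeros {l : ℝ} (hl : 0 < l) {θ : ℂ} (hθ : ‖θ‖ = 1) :
    ∃ lam : ℤ → ℝ, StrictMono lam ∧ range lam = {x : ℝ | charFn l θ (x : ℂ) = 0} := by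
  obtain ⟨c, rfl⟩ := IsAlgClosed.exists_pow_nat_eq θ (n := 2) two_pos
  have hc : ‖c‖ = 1 := by
    rw [norm_pow] at hθ
    exact (pow_eq_one_iff_of_nonneg (norm_nonneg _) two_ne_zero).1 hθ
  have hzero : ∀ t, t ≠ 0 → realChar c t = 0 → charFn l (c ^ 2) ((t / l : ℝ) : ℂ) = 0 := by
    intro t ht h
    rw [charFn_ofReal_eq_zero_iff hc (div_ne_zero ht hl.ne'), div_mul_cancel₀ _ hl.ne', h]
  refine exists_strictMono_int_range_eq (finite_charFn_zeros hl hc) (fun M => ?_) fun M => ?_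
  -- The maximum with `0` keeps away from the spurious zero `t = 0` of `realChar`.
  · obtain ⟨-, t, ht, h0, -⟩ := exists_realChar_zero_gt hc (max 0 (M * l))
    refine ⟨t / l, hzero t (((le_max_left _ _).trans_lt ht).ne') h0, ?_⟩
    rw [lt_div_iff₀ hl]
    exact (le_max_right _ _).trans_lt ht
  · obtain ⟨t, ht, h0⟩ := exists_realChar_zero_lt hc (min 0 (M * l))
    refine ⟨t / l, hzero t ((ht.trans_le (min_le_left _ _)).ne) h0, ?_⟩
    rw [div_lt_iff₀ hl]
    exact ht.trans_le (min_le_right _ _)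

/-! ### Resolvents of symmetric operators -/

/-- The algebraic inverse `R` satisfies `⟨Rf, (A - z̄)v⟩ = ⟨f, v⟩`. Since `A - z̄` is onto, this
identifies limits of `R` weakly, so its graph is closed and the closed graph theorem applies. -/
lemma notMem_unboundedSpectrum_of_symmetric {H : Type*} [NormedAddCommGroup H]
    [InnerProductSpace ℂ H] [CompleteSpace H] (A : H →ₗ.[ℂ] H)
    (hsymm : ∀ u v : A.domain, inner ℂ (A u) (v : H) = inner ℂ (u : H) (A v)) (z : ℂ)
    (hinj : ∀ u : A.domain, A u = z • (u : H) → u = 0)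
    (hsurj : ∀ f : H, ∃ u : A.domain, A u - z • (u : H) = f)
    (hsurj' : ∀ f : H, ∃ u : A.domain, A u - star z • (u : H) = f) :
    z ∉ unboundedSpectrum A := by
  let T : A.domain →ₗ[ℂ] H := A.toFun - z • A.domain.subtype
  have hT : ∀ u, T u = A u - z • (u : H) := fun u => rfl
  have hbij : Function.Bijective T := by
    refine ⟨(injective_iff_map_eq_zero T).2 fun u hu => hinj u ?_, hsurj⟩
    rwa [hT, sub_eq_zero] at hu
  let e := LinearEquiv.ofBijective T hbij
  let R : H →ₗ[ℂ] H := A.domain.subtype ∘ₗ e.symm.toLinearMap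
  have he : ∀ f, A (e.symm f) - z • (e.symm f : H) = f := fun f => e.apply_symm_apply f
  have hadj : ∀ (f : H) (v : A.domain), inner ℂ (R f) (A v - star z • (v : H)) = inner ℂ f v := by
    intro f v
    conv_rhs => rw [← he f]
    rw [inner_sub_right, inner_sub_left, inner_smul_right, inner_smul_left, hsymm]
    rfl
  have hcont : Continuous R := by
    refine R.continuous_of_seq_closed_graph fun u x y hu hRu => ?_
    refine ext_inner_right ℂ fun w => ?_
    obtain ⟨v, rfl⟩ := hsurj' w
    rw [hadj]
    refine tendsto_nhds_unique (hRu.inner tendsto_const_nhds) ?_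
    simp only [Function.comp_apply, hadj]
    exact hu.inner tendsto_const_nhds
  intro hz
  exact hz ⟨⟨R, hcont⟩, fun f => ⟨(e.symm f).2, he f⟩,
    fun y => congrArg Subtype.val (e.symm_apply_apply y)⟩

lemma mem_unboundedEigenspace {H : Type*} [NormedAddCommGroup H] [NormedSpace ℂ H]
    (A : H →ₗ.[ℂ] H) (μ : ℂ) (u : H) :
    u ∈ unboundedEigenspace A μ ↔ (u, μ • u) ∈ A.graph := by
  rw [unboundedEigenspace, LinearPMap.mem_graph_iff]
  constructor
  · rintro ⟨v, hv, rfl⟩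
    exact ⟨v, rfl, sub_eq_zero.1 (show A v - μ • (v : H) = 0 from hv)⟩
  · rintro ⟨v, rfl, hv⟩
    exact ⟨v, show A v - μ • (v : H) = 0 from sub_eq_zero.2 hv, rfl⟩

lemma mem_unboundedSpectrum_of_eigenvector {H : Type*} [NormedAddCommGroup H] [NormedSpace ℂ H]
    (A : H →ₗ.[ℂ] H) (μ : ℂ) {u : H} (hu : (u, μ • u) ∈ A.graph) (hu0 : u ≠ 0) :
    μ ∈ unboundedSpectrum A := by
  rintro ⟨R, -, hR⟩
  obtain ⟨v, hv, hAv⟩ := (LinearPMap.mem_graph_iff A).1 hu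
  have h := hR v
  simp only at hv hAv
  rw [hAv, ← hv, sub_self, map_zero] at h
  exact hu0 (by rw [← hv, ← h])

/-! ### The operator `i y'''` -/

lemma star_theta_mul {θ : ℂ} (hθ : ‖θ‖ = 1) : star θ * θ = 1 := by
  have := Complex.normSq_eq_conj_mul_self (z := θ)
  rw [Complex.normSq_eq_norm_sq, hθ] at this
  simpa using this.symm

/-- Multiplied by `i`, the difference of the inner products is the Lagrange integral. The Dirichlet
conditions leave only the first-derivative boundary terms, which cancel because `|θ| = 1`. -/
lemma inner_opGraph {l : ℝ} (hl : 0 < l) {θ : ℂ} (hθ : ‖θ‖ = 1) {p q : L2Interval l × L2Interval l}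
    (hp : p ∈ opGraph l θ) (hq : q ∈ opGraph l θ) : inner ℂ p.2 q.1 = inner ℂ p.1 q.2 := by
  obtain ⟨y, y₁, y₂, y₃, hy, a, b, c, d, e⟩ := hp
  obtain ⟨z, z₁, z₂, z₃, hz, a', b', c', d', e'⟩ := hq
  have hae : (fun x => Complex.I * (inner ℂ (p.2 x) (q.1 x) - inner ℂ (p.1 x) (q.2 x)))
      =ᵐ[volume.restrict (Ioo 0 l)] fun x => star (y₃ x) * z x + star (y x) * z₃ x := by
    filter_upwards [d, e, d', e'] with x h1 h2 h3 h4
    rw [h1, h2, h3, h4]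
    simp only [RCLike.inner_apply, map_mul, Complex.conj_I, Complex.star_def]
    linear_combination -(z x * (starRingEnd ℂ) (y₃ x) + z₃ x * (starRingEnd ℂ) (y x))
      * Complex.I_sq
  have hi1 := L2.integrable_inner (𝕜 := ℂ) p.2 q.1
  have hi2 := L2.integrable_inner (𝕜 := ℂ) p.1 q.2
  have hint : IntervalIntegrable (fun x => star (y₃ x) * z x + star (y x) * z₃ x) volume 0 l := by
    rw [intervalIntegrable_iff_integrableOn_Ioo_of_le hl.le]
    exact ((hi1.sub hi2).const_mul Complex.I).congr hae
  have hL := hy.integral_lagrange hl.le hz hint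
  rw [intervalIntegral.integral_of_le hl.le, integral_Ioc_eq_integral_Ioo, ← integral_congr_ae hae,
    integral_const_mul, integral_sub hi1 hi2, ← L2.inner_def, ← L2.inner_def,
    a, a', c, c', b, b', star_mul'] at hL
  have h0 : Complex.I * (inner ℂ p.2 q.1 - inner ℂ p.1 q.2) = 0 := by
    rw [hL, star_zero]
    linear_combination -star (y₁ 0) * z₁ 0 * star_theta_mul hθ
  exact sub_eq_zero.1 ((mul_eq_zero.1 h0).resolve_left Complex.I_ne_zero)

lemma star_eq_of_eigenvector {l : ℝ} (hl : 0 < l) {θ : ℂ} (hθ : ‖θ‖ = 1) {μ : ℂ}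
    {u : L2Interval l} (hu : (u, μ • u) ∈ opGraph l θ) (hu0 : u ≠ 0) : star μ = μ := by
  have h := inner_opGraph hl hθ hu hu
  simp only [inner_smul_left, inner_smul_right] at h
  exact mul_right_cancel₀ (inner_self_ne_zero.2 hu0) h

/-- The boundary conditions of the domain for the function `a solOne + b solTwo`. -/
def BoundaryCond (l : ℝ) (θ lam a b : ℂ) : Prop :=
  a * solOne lam l + b * solTwo lam l = 0 ∧ a * solZero lam l + b * solOne lam l = θ * a

lemma continuous_sol (lam a b : ℂ) :
    Continuous fun x => a * solOne lam x + b * solTwo lam x := by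
  have := continuous_solOne lam
  have := continuous_solTwo lam
  fun_prop

lemma mem_opGraph_of_boundaryCond {l : ℝ} (hl : 0 < l) {θ lam a b : ℂ}
    (h : BoundaryCond l θ lam a b) {u : L2Interval l}
    (hu : u =ᵐ[volume.restrict (Ioo (0 : ℝ) l)] fun x => a * solOne lam x + b * solTwo lam x) :
    (u, lam ^ 3 • u) ∈ opGraph l θ := by
  refine ⟨_, _, _, _, IsSobolevThree.sol hl.le lam a b, by simp, by simpa using h.2, h.1, hu, ?_⟩
  filter_upwards [hu, Lp.coeFn_smul (lam ^ 3) u] with x h1 h2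
  rw [h2, Pi.smul_apply, h1, smul_eq_mul]
  linear_combination -(lam ^ 3) * (a * solOne lam x + b * solTwo lam x) *
    (Complex.I ^ 2 - 1) * Complex.I_sq

lemma boundaryCond_of_mem_opGraph {l : ℝ} (hl : 0 < l) {θ lam : ℂ} {u : L2Interval l}
    (h : (u, lam ^ 3 • u) ∈ opGraph l θ) : ∃ a b, BoundaryCond l θ lam a b ∧
      u =ᵐ[volume.restrict (Ioo (0 : ℝ) l)] fun x => a * solOne lam x + b * solTwo lam x := by
  obtain ⟨y, y₁, y₂, y₃, hy, ha, hb, hc, d, e⟩ := h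
  have h3 : ∀ᵐ x ∂volume.restrict (Ioo (0 : ℝ) l), y₃ x = (Complex.I * lam) ^ 3 * y x := by
    filter_upwards [d, e, Lp.coeFn_smul (lam ^ 3) u] with x h1 h2 h3
    rw [h3, Pi.smul_apply, h1, smul_eq_mul] at h2
    linear_combination Complex.I * h2 + (y₃ x - Complex.I * lam ^ 3 * y x) * Complex.I_sq
  have hsol := hy.eq_sol lam h3
  have hsol' : ∀ x ∈ Icc 0 l, y x = y₁ 0 * solOne lam x + y₂ 0 * solTwo lam x := by
    intro x hx
    rw [hsol x hx, ha]
    ring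
  -- The value `y'(l)` is read off by differentiating the representation one-sidedly at the
  -- endpoint.
  have hd : HasDerivWithinAt y (y₁ 0 * solZero lam l + y₂ 0 * solOne lam l) (Icc 0 l) l :=
    (((hasDerivAt_solOne lam l).const_mul (y₁ 0)).fun_add
      ((hasDerivAt_solTwo lam l).const_mul (y₂ 0))).hasDerivWithinAt.congr hsol'
      (hsol' l (right_mem_Icc.2 hl.le))
  have hy1 := (uniqueDiffOn_Icc hl l (right_mem_Icc.2 hl.le)).eq_deriv _ hd
    (hy.hasDeriv_zero l (right_mem_Icc.2 hl.le))
  refine ⟨y₁ 0, y₂ 0, ⟨?_, ?_⟩, ?_⟩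
  · rw [← hsol' l (right_mem_Icc.2 hl.le), hc]
  · rw [hy1, hb]
  · filter_upwards [d, ae_restrict_mem measurableSet_Ioo] with x h1 hx
    rw [h1, hsol' x (Ioo_subset_Icc_self hx)]

/-- The first and second derivatives at `0` are `a` and `b`. -/
lemma eq_zero_of_sol_eq_zero {l : ℝ} (hl : 0 < l) {lam a b : ℂ}
    (h : ∀ x ∈ Ioo 0 l, a * solOne lam x + b * solTwo lam x = 0) : a = 0 ∧ b = 0 := by
  have step : ∀ f g : ℝ → ℂ, (∀ x ∈ Ioo 0 l, f x = 0) → (∀ x, HasDerivAt f (g x) x) →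
      ∀ x ∈ Ioo 0 l, g x = 0 := by
    intro f g hf hg x hx
    refine (hg x).unique ((hasDerivAt_const x (0 : ℂ)).congr_of_eventuallyEq ?_)
    filter_upwards [Ioo_mem_nhds hx.1 hx.2] with t ht using hf t ht
  have atZero : ∀ g : ℝ → ℂ, Continuous g → (∀ x ∈ Ioo 0 l, g x = 0) → g 0 = 0 := by
    intro g hg h
    have : EqOn g (fun _ => 0) (closure (Ioo 0 l)) := EqOn.closure h hg continuous_const
    exact this (by rw [closure_Ioo hl.ne]; exact left_mem_Icc.2 hl.le)
  have c0 := continuous_solZero lam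
  have c1 := continuous_solOne lam
  have c2 := continuous_solTwo lam
  have h1 := step _ _ h fun x => ((hasDerivAt_solOne lam x).const_mul a).fun_add
    ((hasDerivAt_solTwo lam x).const_mul b)
  have h2 := step _ _ h1 fun x => ((hasDerivAt_solZero lam x).const_mul a).fun_add
    ((hasDerivAt_solOne lam x).const_mul b)
  have e1 := atZero _ (by fun_prop) h1
  have e2 := atZero _ (by fun_prop) h2
  simp only [solZero_zero, solOne_zero, solTwo_zero, mul_one, mul_zero, add_zero, zero_add] at e1 e2
  exact ⟨e1, e2⟩

lemma ne_zero_of_ae_eq_sol {l : ℝ} (hl : 0 < l) {lam a b : ℂ} {u : L2Interval l}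
    (hu : u =ᵐ[volume.restrict (Ioo (0 : ℝ) l)] fun x => a * solOne lam x + b * solTwo lam x)
    (hab : ¬(a = 0 ∧ b = 0)) : u ≠ 0 := by
  rintro rfl
  refine hab (eq_zero_of_sol_eq_zero (lam := lam) hl ?_)
  have hae : (fun x => a * solOne lam x + b * solTwo lam x)
      =ᵐ[volume.restrict (Ioo (0 : ℝ) l)] fun _ => (0 : ℂ) := by
    filter_upwards [hu, Lp.coeFn_zero ℂ 2 (volume.restrict (Ioo (0 : ℝ) l))] with x h1 h2
    rw [← h1, h2]
    rfl
  exact Measure.eqOn_open_of_ae_eq hae isOpen_Ioo (continuous_sol lam a b).continuousOn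
    continuousOn_const

lemma exists_eigenvector {l : ℝ} (hl : 0 < l) {θ lam : ℂ} (h : charFn l θ lam = 0) :
    ∃ u : L2Interval l, u ≠ 0 ∧ (u, lam ^ 3 • u) ∈ opGraph l θ := by
  obtain ⟨a, b, hab, hbc⟩ : ∃ a b, ¬(a = 0 ∧ b = 0) ∧ BoundaryCond l θ lam a b := by
    rw [charFn_eq_det] at h
    -- In the degenerate case `solTwo` itself meets the boundary conditions. Otherwise `(-S₂(l),
    -- S₁(l))` solves the first condition, and the vanishing determinant yields the second.
    by_cases h0 : solOne lam l = 0 ∧ solTwo lam l = 0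
    · exact ⟨0, 1, by simp, by simp [h0.2], by simp [h0.1]⟩
    · refine ⟨-solTwo lam l, solOne lam l, fun H => h0 ⟨H.2, neg_eq_zero.1 H.1⟩, by ring, ?_⟩
      linear_combination -h
  have hm := memLp_of_continuous (l := l) (continuous_sol lam a b)
  exact ⟨hm.toLp, ne_zero_of_ae_eq_sol hl hm.coeFn_toLp hab,
    mem_opGraph_of_boundaryCond hl hbc hm.coeFn_toLp⟩

lemma eq_zero_of_mem_opGraph {l : ℝ} (hl : 0 < l) {θ lam : ℂ} (h : charFn l θ lam ≠ 0)
    {u : L2Interval l} (hu : (u, lam ^ 3 • u) ∈ opGraph l θ) : u = 0 := by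
  obtain ⟨a, b, ⟨h1, h2⟩, hae⟩ := boundaryCond_of_mem_opGraph hl hu
  rw [charFn_eq_det] at h
  have ha : a = 0 := (mul_eq_zero.1 (by
    linear_combination solTwo lam l * h2 - solOne lam l * h1 : a * _ = 0)).resolve_right h
  have hb : b = 0 := (mul_eq_zero.1 (by
    linear_combination (solZero lam l - θ) * h1 - solOne lam l * h2 : b * _ = 0)).resolve_right h
  refine Lp.ext ?_
  filter_upwards [hae, Lp.coeFn_zero ℂ 2 (volume.restrict (Ioo (0 : ℝ) l))] with x e1 e2
  rw [e1, e2, ha, hb]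
  simp

lemma exists_mem_opGraph {l : ℝ} (hl : 0 < l) {θ lam : ℂ} (h : charFn l θ lam ≠ 0)
    (f : L2Interval l) : ∃ u : L2Interval l, (u, f + lam ^ 3 • u) ∈ opGraph l θ := by
  -- The equation `i y''' = λ³ y + f` reads `y''' = (iλ)³ y - i f`.
  obtain ⟨y, y₁, y₂, y₃, hy, h0, h1, h3⟩ :=
    IsSobolevThree.exists_particular hl.le lam ((Lp.memLp f).const_mul (-Complex.I))
  rw [charFn_eq_det] at h
  set D := solTwo lam l * (solZero lam l - θ) - solOne lam l ^ 2
  -- Cramer's rule for the correction `a S₁ + b S₂` restoring both conditions that involve `l`.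
  set a := (y l * solOne lam l - y₁ l * solTwo lam l) / D with ha
  set b := (y₁ l * solOne lam l - y l * (solZero lam l - θ)) / D with hb
  have hz := hy.add (IsSobolevThree.sol hl.le lam a b)
  have hc : ContinuousOn (y + fun x => a * solOne lam x + b * solTwo lam x) (Icc 0 l) :=
    hz.continuousOn_zero
  have hm : MemLp (y + fun x => a * solOne lam x + b * solTwo lam x) 2
      (volume.restrict (Ioo (0 : ℝ) l)) := by
    obtain ⟨C, hC⟩ := isCompact_Icc.exists_bound_of_continuousOn hc
    refine MemLp.of_bound ((hc.mono Ioo_subset_Icc_self).aestronglyMeasurable measurableSet_Ioo)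
      C ?_
    filter_upwards [ae_restrict_mem measurableSet_Ioo] with x hx
      using hC x (Ioo_subset_Icc_self hx)
  refine ⟨hm.toLp, _, _, _, _, hz, by simp [h0], ?_, ?_, hm.coeFn_toLp, ?_⟩
  · simp only [Pi.add_apply, h1, solZero_zero, solOne_zero]
    rw [ha, hb]
    field_simp
    ring
  · simp only [Pi.add_apply]
    rw [ha, hb]
    field_simp
    ring
  · filter_upwards [h3, hm.coeFn_toLp, Lp.coeFn_add f (lam ^ 3 • hm.toLp),
      Lp.coeFn_smul (lam ^ 3) hm.toLp] with x e1 e2 e3 e4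
    rw [e3, Pi.add_apply, e4, Pi.smul_apply, e2, smul_eq_mul]
    simp only [Pi.add_apply, e1]
    linear_combination (f x - lam ^ 3 * (y x + (a * solOne lam x + b * solTwo lam x)) *
      (Complex.I ^ 2 - 1)) * Complex.I_sq

/-! ### The spectrum in terms of the characteristic function -/

lemma opL_eq_of_mem {l : ℝ} (hl : 0 < l) {θ : ℂ} {u v : L2Interval l} (h : (u, v) ∈ opGraph l θ) :
    ∃ w : (opL l θ).domain, (w : L2Interval l) = u ∧ opL l θ w = v := by
  rw [← opL_graph hl θ] at h
  exact (LinearPMap.mem_graph_iff _).1 h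

lemma opL_mem_opGraph {l : ℝ} (hl : 0 < l) {θ : ℂ} (w : (opL l θ).domain) :
    ((w : L2Interval l), opL l θ w) ∈ opGraph l θ := by
  rw [← opL_graph hl θ]
  exact LinearPMap.mem_graph _ w

/-- A zero at the conjugate would make its cube a real eigenvalue, hence equal to `lam ^ 3`, and
`charFn` depends only on the cube. -/
lemma charFn_star_ne_zero {l : ℝ} (hl : 0 < l) {θ : ℂ} (hθ : ‖θ‖ = 1) {lam : ℂ}
    (h : charFn l θ lam ≠ 0) : charFn l θ (star lam) ≠ 0 := by
  intro h0
  obtain ⟨u, hu0, hu⟩ := exists_eigenvector hl h0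
  have hs := star_eq_of_eigenvector hl hθ hu hu0
  rw [star_pow, star_star] at hs
  exact h (by rw [charFn_eq_of_cube_eq l θ hs, h0])

lemma notMem_spectrum_of_charFn_ne_zero {l : ℝ} (hl : 0 < l) {θ : ℂ} (hθ : ‖θ‖ = 1) {lam : ℂ}
    (h : charFn l θ lam ≠ 0) : lam ^ 3 ∉ unboundedSpectrum (opL l θ) := by
  have hsurj : ∀ lam : ℂ, charFn l θ lam ≠ 0 → ∀ f : L2Interval l,
      ∃ u : (opL l θ).domain, opL l θ u - lam ^ 3 • (u : L2Interval l) = f := by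
    intro lam h f
    obtain ⟨u, hu⟩ := exists_mem_opGraph hl h f
    obtain ⟨w, rfl, hw⟩ := opL_eq_of_mem hl hu
    exact ⟨w, by rw [hw, add_sub_cancel_right]⟩
  refine notMem_unboundedSpectrum_of_symmetric _ (fun u v => ?_) _ (fun u hu => ?_) (hsurj lam h) ?_
  · exact inner_opGraph hl hθ (opL_mem_opGraph hl u) (opL_mem_opGraph hl v)
  · have := opL_mem_opGraph hl u
    rw [hu] at this
    exact Subtype.ext (eq_zero_of_mem_opGraph hl h this)
  · rw [star_pow]
    exact hsurj _ (charFn_star_ne_zero hl hθ h)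

lemma mem_spectrum_iff {l : ℝ} (hl : 0 < l) {θ : ℂ} (hθ : ‖θ‖ = 1) (lam : ℂ) :
    lam ^ 3 ∈ unboundedSpectrum (opL l θ) ↔ charFn l θ lam = 0 := by
  refine ⟨fun h => by_contra fun h0 => notMem_spectrum_of_charFn_ne_zero hl hθ h0 h, fun h => ?_⟩
  obtain ⟨u, hu0, hu⟩ := exists_eigenvector hl h
  rw [← opL_graph hl θ] at hu
  exact mem_unboundedSpectrum_of_eigenvector _ _ hu hu0

lemma exists_cube_eq (r : ℝ) : ∃ x : ℝ, x ^ 3 = r := by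
  rcases le_total 0 r with h | h
  · exact ⟨_, Real.rpow_inv_natCast_pow h three_ne_zero⟩
  · refine ⟨-(-r) ^ (((3 : ℕ) : ℝ)⁻¹), ?_⟩
    rw [Odd.neg_pow (by decide), Real.rpow_inv_natCast_pow (by linarith) three_ne_zero, neg_neg]

/-- Every point of the spectrum is the cube of a real zero of the characteristic function. -/
lemma mem_spectrum_iff_real {l : ℝ} (hl : 0 < l) {θ : ℂ} (hθ : ‖θ‖ = 1) (μ : ℂ) :
    μ ∈ unboundedSpectrum (opL l θ) ↔ ∃ x : ℝ, charFn l θ x = 0 ∧ (x : ℂ) ^ 3 = μ := by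
  constructor
  · intro h
    obtain ⟨lam, rfl⟩ := IsAlgClosed.exists_pow_nat_eq μ (n := 3) three_pos
    rw [mem_spectrum_iff hl hθ] at h
    obtain ⟨u, hu0, hu⟩ := exists_eigenvector hl h
    have hs := star_eq_of_eigenvector hl hθ hu hu0
    obtain ⟨r, hr⟩ := Complex.conj_eq_iff_real.1 hs
    -- The eigenvalue is real, so the zero can be moved to its real cube root.
    obtain ⟨x, hx⟩ := exists_cube_eq r
    have hx' : (x : ℂ) ^ 3 = lam ^ 3 := by rw [hr, ← hx]; push_cast; rfl
    exact ⟨x, by rw [charFn_eq_of_cube_eq l θ hx', h], hx'⟩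
  · rintro ⟨x, hx, rfl⟩
    exact (mem_spectrum_iff hl hθ _).2 hx

/-- For `x ≠ 0`, common vanishing forces the exponentials at `ζ` and `ζ²` to coincide, but their
moduli `exp(∓√3xl/2)` differ. -/
lemma solOne_solTwo_ne_zero {l : ℝ} (hl : 0 < l) (x : ℝ) :
    ¬(solOne (x : ℂ) l = 0 ∧ solTwo (x : ℂ) l = 0) := by
  rintro ⟨h1, h2⟩
  by_cases hx : x = 0
  · simp [solOne, hx, hl.ne'] at h1
  have hxc : (x : ℂ) ≠ 0 := by exact_mod_cast hx
  have hI := Complex.I_ne_zero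
  have e : Complex.I * (x : ℂ) * l = Complex.I * ((x * l : ℝ) : ℂ) := by push_cast; ring
  rw [solOne, if_neg hxc, e, div_eq_zero_iff, or_iff_left (mul_ne_zero hI hxc)] at h1
  rw [solTwo, if_neg hxc, e, div_eq_zero_iff, or_iff_left (pow_ne_zero 2 (mul_ne_zero hI hxc))] at h2
  rw [trigS_one_eq] at h1
  rw [trigS_two_eq] at h2
  have hz : zeta 1 - 1 ≠ 0 := by
    intro h
    have := zeta_one_quadratic
    rw [sub_eq_zero.1 h] at this
    norm_num at this
  have hE : Complex.exp (Complex.I * ((x * l : ℝ) : ℂ) * zeta 1) =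
      Complex.exp (Complex.I * ((x * l : ℝ) : ℂ) * zeta 1 ^ 2) := by
    refine sub_eq_zero.1 ((mul_eq_zero.1 ?_).resolve_left (mul_ne_zero zeta_one_ne_zero hz))
    linear_combination 3 * h1 - 3 * h2
  have hn := congrArg norm hE
  rw [exp_I_mul_zeta, exp_I_mul_zeta_sq, norm_mul, norm_mul, Complex.norm_exp_ofReal_mul_I,
    Complex.norm_real, Complex.norm_real, Real.norm_of_nonneg (Real.exp_pos _).le,
    Real.norm_of_nonneg (Real.exp_pos _).le, mul_one, mul_one, Real.exp_eq_exp] at hn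
  have h3 : Real.sqrt 3 ≠ 0 := by positivity
  have : Real.sqrt 3 * (x * l) = 0 := by linarith
  simp [h3, hx, hl.ne'] at this

/-! ### Normalized eigenfunctions and simplicity -/

lemma eigenFnRaw_eq (l : ℝ) (lam : ℂ) (x : ℝ) :
    eigenFnRaw l lam x = -solTwo lam l * solOne lam x + solOne lam l * solTwo lam x := by
  rw [eigenFnRaw]
  ring

lemma continuous_eigenFnRaw (l : ℝ) (lam : ℂ) : Continuous (eigenFnRaw l lam) := by
  rw [funext (eigenFnRaw_eq l lam)]
  exact continuous_sol _ _ _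

lemma integral_eigenFnRaw_pos {l : ℝ} (hl : 0 < l) (x : ℝ) :
    0 < ∫ t in (0 : ℝ)..l, ‖eigenFnRaw l (x : ℂ) t‖ ^ 2 := by
  refine intervalIntegral.integral_pos hl
    ((continuous_eigenFnRaw l x).norm.pow 2).continuousOn (fun _ _ => by positivity) ?_
  by_contra! H
  have := eq_zero_of_sol_eq_zero (lam := x) (a := -solTwo x l) (b := solOne x l) hl (by
    intro t ht
    have h1 := H t (Ioo_subset_Icc_self ht)
    rw [← eigenFnRaw_eq]
    exact norm_eq_zero.1 (pow_eq_zero_iff two_ne_zero |>.1 (le_antisymm h1 (by positivity))))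
  exact solOne_solTwo_ne_zero hl x ⟨this.2, neg_eq_zero.1 this.1⟩

lemma normConst_pos {l : ℝ} (hl : 0 < l) (x : ℝ) : 0 < normConst l (x : ℂ) :=
  Real.sqrt_pos.2 (integral_eigenFnRaw_pos hl x)

lemma eigenFn_eq (l : ℝ) (lam : ℂ) (x : ℝ) : eigenFn l lam x =
    (-solTwo lam l / normConst l lam) * solOne lam x
      + (solOne lam l / normConst l lam) * solTwo lam x := by
  rw [eigenFn, eigenFnRaw_eq]
  ring

lemma exists_eigenFn_toLp {l : ℝ} (hl : 0 < l) (x : ℝ) : ∃ Ψ : L2Interval l,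
    Ψ =ᵐ[volume.restrict (Ioo (0 : ℝ) l)] eigenFn l (x : ℂ) ∧ ‖Ψ‖ = 1 := by
  have hm : MemLp (eigenFn l (x : ℂ)) 2 (volume.restrict (Ioo (0 : ℝ) l)) := by
    rw [funext (eigenFn_eq l x)]
    exact memLp_of_continuous (continuous_sol _ _ _)
  refine ⟨hm.toLp, hm.coeFn_toLp, ?_⟩
  have hN := normConst_pos hl x
  have hsq : ‖hm.toLp‖ ^ 2 = 1 := by
    have h : inner ℂ hm.toLp hm.toLp = (‖hm.toLp‖ : ℂ) ^ 2 := inner_self_eq_norm_sq_to_K _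
    have h2 : inner ℂ hm.toLp hm.toLp = ((∫ t in Ioo (0 : ℝ) l, ‖eigenFn l x t‖ ^ 2 : ℝ) : ℂ) := by
      rw [L2.inner_def, ← integral_complex_ofReal]
      refine integral_congr_ae ?_
      filter_upwards [hm.coeFn_toLp] with t ht
      rw [ht, inner_self_eq_norm_sq_to_K]
      push_cast
      rfl
    rw [h] at h2
    have h3 : ‖hm.toLp‖ ^ 2 = ∫ t in Ioo (0 : ℝ) l, ‖eigenFn l x t‖ ^ 2 := by exact_mod_cast h2
    have h4 : ∀ t, ‖eigenFn l x t‖ ^ 2 = (normConst l x ^ 2)⁻¹ * ‖eigenFnRaw l x t‖ ^ 2 := by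
      intro t
      rw [eigenFn, norm_mul, norm_div, norm_one, Complex.norm_real, Real.norm_of_nonneg hN.le]
      ring
    simp only [h4] at h3
    rw [integral_const_mul, ← integral_Ioc_eq_integral_Ioo,
      ← intervalIntegral.integral_of_le hl.le] at h3
    rw [h3, normConst, Real.sq_sqrt (integral_eigenFnRaw_pos hl x).le]
    exact inv_mul_cancel₀ (integral_eigenFnRaw_pos hl x).ne'
  exact (pow_eq_one_iff_of_nonneg (norm_nonneg _) two_ne_zero).1 hsq

lemma eigenspace_eq_span {l : ℝ} (hl : 0 < l) {θ : ℂ} {x : ℝ} (h : charFn l θ x = 0)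
    {Ψ : L2Interval l} (hΨ : Ψ =ᵐ[volume.restrict (Ioo (0 : ℝ) l)] eigenFn l (x : ℂ)) :
    unboundedEigenspace (opL l θ) ((x : ℂ) ^ 3) = Submodule.span ℂ {Ψ} := by
  have hN : (normConst l (x : ℂ) : ℂ) ≠ 0 := by exact_mod_cast (normConst_pos hl x).ne'
  rw [funext (eigenFn_eq l x)] at hΨ
  refine le_antisymm (fun u hu => ?_) ?_
  · rw [mem_unboundedEigenspace, opL_graph hl] at hu
    obtain ⟨a, b, ⟨h1, -⟩, hae⟩ := boundaryCond_of_mem_opGraph hl hu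
    -- The condition `y(l) = 0` is one nontrivial linear equation in `(a, b)`, so its solutions form
    -- a line.
    obtain ⟨k, hka, hkb⟩ : ∃ k, a = k * (-solTwo x l) ∧ b = k * solOne x l := by
      by_cases hs : solOne (x : ℂ) l = 0
      · have h2 : solTwo (x : ℂ) l ≠ 0 := fun h2 => solOne_solTwo_ne_zero hl x ⟨hs, h2⟩
        have hb : b = 0 := by simpa [hs, h2] using h1
        exact ⟨-a / solTwo x l, by field_simp, by simp [hs, hb]⟩
      · refine ⟨b / solOne x l, ?_, by field_simp⟩
        field_simp
        linear_combination h1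
    refine Submodule.mem_span_singleton.2 ⟨k * normConst l x, Lp.ext ?_⟩
    filter_upwards [hae, hΨ, Lp.coeFn_smul (k * (normConst l (x : ℂ) : ℂ)) Ψ] with t e1 e2 e3
    rw [e1, e3, Pi.smul_apply, e2, smul_eq_mul, hka, hkb]
    field_simp
  · rw [Submodule.span_singleton_le_iff_mem, mem_unboundedEigenspace, opL_graph hl]
    rw [charFn_eq_det] at h
    refine mem_opGraph_of_boundaryCond hl ⟨by ring, ?_⟩ hΨ
    field_simp
    linear_combination -h

theorem theorem1p2 (l : ℝ) (hl : 0 < l) (θ : ℂ) (hθ : ‖θ‖ = 1) :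
    ∃ lam : ℤ → ℝ,
      StrictMono lam ∧
      Set.range lam = {x : ℝ | charFn l θ (x : ℂ) = 0} ∧
      unboundedSpectrum (opL l θ) = Set.range (fun n : ℤ => (lam n : ℂ) ^ 3) ∧
      (∀ μ ∈ unboundedSpectrum (opL l θ),
        Module.finrank ℂ (unboundedEigenspace (opL l θ) μ) = 1) ∧
      (∀ n : ℤ,
        0 < normConst l (lam n : ℂ) ∧
        ∃ Ψ : L2Interval l,
          (Ψ : ℝ → ℂ) =ᵐ[MeasureTheory.volume.restrict (Set.Ioo (0 : ℝ) l)]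
            eigenFn l (lam n : ℂ) ∧
          ‖Ψ‖ = 1 ∧
          unboundedEigenspace (opL l θ) ((lam n : ℂ) ^ 3) = Submodule.span ℂ {Ψ}) ∧
      (∀ (w : ℂ) (x : ℝ), eigenFn l (w * zeta 1) x = eigenFn l w x) := by
  obtain ⟨lam, hmono, hrange⟩ := exists_strictMono_charFn_zeros hl hθ
  have hzero : ∀ n, charFn l θ (lam n) = 0 := fun n => by
    have : lam n ∈ {x : ℝ | charFn l θ (x : ℂ) = 0} := hrange ▸ mem_range_self n
    exact this
  refine ⟨lam, hmono, hrange, ?_, ?_, ?_, eigenFn_mul_zeta l⟩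
  · ext μ
    rw [mem_spectrum_iff_real hl hθ]
    constructor
    · rintro ⟨x, hx, rfl⟩
      obtain ⟨n, rfl⟩ : x ∈ range lam := hrange ▸ hx
      exact ⟨n, rfl⟩
    · rintro ⟨n, rfl⟩
      exact ⟨lam n, hzero n, rfl⟩
  · intro μ hμ
    obtain ⟨x, hx, rfl⟩ := (mem_spectrum_iff_real hl hθ μ).1 hμ
    obtain ⟨Ψ, hΨ, hnorm⟩ := exists_eigenFn_toLp hl x
    rw [eigenspace_eq_span hl hx hΨ]
    exact finrank_span_singleton (norm_ne_zero_iff.1 (by rw [hnorm]; exact one_ne_zero))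
  · intro n
    obtain ⟨Ψ, hΨ, hnorm⟩ := exists_eigenFn_toLp hl (lam n)
    exact ⟨normConst_pos hl _, Ψ, hΨ, hnorm, eigenspace_eq_span hl (hzero n) hΨ⟩
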